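/- Let $C_4'$ be the graph with vertices $0_j,u_j,0'_j,d_j$ ($j\in\mathbb Z$) and edges $\{0_j,u_j\},\{u_j,0'_j\},\{0'_j,d_j\},\{d_j,0_j\},\{0_j,0'_{j+1}\}$ ($j\in\mathbb Z$), and let $A$ be its set of arcs; an arc $e$ has origin $o(e)$, terminus $t(e)$ and inverse $\bar e$. The Grover walk on $C_4'$ is the unitary operator $U$ on $\ell^2(A)$ with $$\langle\delta_f,U\delta_e\rangle=\Big(\frac{2}{\deg o(e)}-\delta_{e,\bar f}\Big)\mathbf 1_{\{o(e)=t(f)\}} .$$ For an initial state $\Psi_0$ and $\Psi_t=U^t\Psi_0$, the position $X_t\in\mathbb Z$ has law $\mathbb P(X_t=j)=\sum_{e:\,o(e)\in\{0_j,u_j,0'_j,d_j\}}|\Psi_t(e)|^2$. Choose $\Psi_0$ uniformly at random among the ten basis states $\delta_e$ with $o(e)\in\{0_0,u_0,0'_0,d_0\}$, and let $\mathbb P$ denote the resulting averaged law of $X_t$. For $k\in\mathbb R$, $j\in\{0,1,2\}$, $l\in\{0,1\}$ put $$\lambda_j(k)=\frac{2\sqrt7}{3\sqrt3}\cos\Big\{\frac13\arccos\Big(\frac{9\sqrt3}{7\sqrt7}\cos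 k\Big)+\frac{2j\pi}{3}\Big\},\qquad \nu_{j,l}(k)=\lambda_j(k)+(-1)^l i\sqrt{1-\lambda_j(k)^2},\qquad x_{j,l}(k)=\frac{i\,\nu_{j,l}'(k)}{\nu_{j,l}(k)} .$$ (The $\lambda_j(k)$ are the roots of $9\lambda^3-7\lambda-2\cos k=0$.) Then there are functions $\nu_0,\nu_1:\mathbb R\to[0,\infty)$ such that for every $x\in\mathbb R$ $$\lim_{t\to\infty}\mathbb P\Big(\frac{X_t}{t}\le x\Big)=\int_{-\infty}^x\Big\{\frac25\,\delta_0(y)+\frac35\big(\nu_0(y)+\nu_1(y)\big)\Big\}\,dy ,$$ where the atom at $0$ is counted when $x\ge 0$, and such that: 1. $\nu_0$ is positive exactly on $(-1/\sqrt{10},1/\sqrt{10})$ and continuous there, and $\nu_1$ is positive exactly on $(-2/7,2/7)$ and continuous there. 2. $\nu_0(x)\to\infty$ as $|x|\uparrow 1/\sqrt{10}$, and $\nu_1(x)\to\infty$ as $|x|\uparrow 2/7$. 3. $\nu_{0,0}$ and $x_{0,0}$ are differentiable on $(0,2\pi)$, $\nu_{2,0}$ and $x_{2,0}$ are differentiable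 on $(-\pi/2,\pi/2)$, the derivatives $x_{0,0}'$ and $x_{2,0}'$ do not vanish on these intervals, and $$\Big\{(x,\nu_0(x)):|x|<\tfrac1{\sqrt{10}}\Big\}=\Big\{\Big(x_{0,0}(k),\frac1{3\pi|x_{0,0}'(k)|}\Big):0<k<2\pi\Big\},$$ $$\Big\{(x,\nu_1(x)):|x|<\tfrac27\Big\}=\Big\{\Big(x_{2,0}(k),\frac1{3\pi|x_{2,0}'(k)|}\Big):-\tfrac{\pi}{2}<k<\tfrac{\pi}{2}\Big\}.$$ -/

import Mathlib

open Set Filter Topology MeasureTheory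
open scoped ENNReal

/-! ### The Grover walk on a locally finite graph -/

section Grover

variable {V : Type*} [DecidableEq V] (G : SimpleGraph V) [G.LocallyFinite]

/-- The arcs of `G` are its darts; the arc `e` has origin `e.fst`, terminus `e.snd` and
inverse arc `e.symm`. This is the Hilbert space `ℓ²(A(G))`. -/
abbrev ArcSpace : Type _ := lp (fun _ : G.Dart => ℂ) 2

/-- The matrix element `⟨δ_f, U δ_e⟩ = (2 / deg o(e) - δ_{e, f̄}) 1_{o(e) = t(f)}`. -/
noncomputable def groverCoeff (e f : G.Dart) : ℂ :=
  if e.fst = f.snd then 2 / (G.degree e.fst : ℂ) - (if e = f.symm then 1 else 0) else 0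

/-- `(U ψ)(f) = ∑_e ⟨δ_f, U δ_e⟩ ψ(e)`; only the finitely many arcs `e` with `o(e) = t(f)`
contribute, and these are the arcs from `t(f)` to its neighbours. -/
noncomputable def groverAmp (ψ : G.Dart → ℂ) (f : G.Dart) : ℂ :=
  ∑ w : G.neighborSet f.snd,
    groverCoeff G (G.dartOfNeighborSet f.snd w) f * ψ (G.dartOfNeighborSet f.snd w)

/-- Arcs sorted by their origin. -/
def arcEquiv : (Σ v : V, G.neighborSet v) ≃ G.Dart where
  toFun p := G.dartOfNeighborSet p.1 p.2
  invFun e := ⟨e.fst, ⟨e.snd, e.adj⟩⟩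
  left_inv _ := rfl
  right_inv _ := rfl

theorem groverAmp_symm (ψ : G.Dart → ℂ) (v : V) (w : G.neighborSet v) :
    groverAmp G ψ (G.dartOfNeighborSet v w).symm =
      2 / (G.degree v : ℂ) * ∑ x : G.neighborSet v, ψ (G.dartOfNeighborSet v x)
        - ψ (G.dartOfNeighborSet v w) := by
  have h : ∀ x : G.neighborSet v,
      groverCoeff G (G.dartOfNeighborSet v x) (G.dartOfNeighborSet v w).symm *
        ψ (G.dartOfNeighborSet v x) =
      2 / (G.degree v : ℂ) * ψ (G.dartOfNeighborSet v x) -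
        (if x = w then ψ (G.dartOfNeighborSet v x) else 0) := by
    intro x
    have h1 : (G.dartOfNeighborSet v x).fst = (G.dartOfNeighborSet v w).symm.snd := rfl
    have h2 : (G.dartOfNeighborSet v x).fst = v := rfl
    have h3 : (G.dartOfNeighborSet v x = (G.dartOfNeighborSet v w).symm.symm) ↔ x = w := by
      rw [SimpleGraph.Dart.symm_symm]
      exact (G.dartOfNeighborSet_injective v).eq_iff
    rw [groverCoeff, if_pos h1, h2]
    simp only [h3]
    split_ifs <;> ring
  have h0 : groverAmp G ψ (G.dartOfNeighborSet v w).symm = ∑ x : G.neighborSet v,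
      groverCoeff G (G.dartOfNeighborSet v x) (G.dartOfNeighborSet v w).symm *
        ψ (G.dartOfNeighborSet v x) := rfl
  rw [h0, Finset.sum_congr rfl (fun x _ => h x), Finset.sum_sub_distrib, ← Finset.mul_sum]
  simp

/-- A reflection `2|φ⟩⟨φ| - 1` in the uniform vector `φ` preserves the norm. -/
theorem sum_sq_reflection {ι : Type*} [Fintype ι] (a : ι → ℂ) :
    ∑ i, ‖2 / (Fintype.card ι : ℂ) * ∑ j, a j - a i‖ ^ 2 = ∑ i, ‖a i‖ ^ 2 := by
  rcases isEmpty_or_nonempty ι with h | h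
  · simp
  have hn : (Fintype.card ι : ℝ) ≠ 0 := by exact_mod_cast Fintype.card_ne_zero
  set n : ℝ := (Fintype.card ι : ℝ) with hnd
  have key : ∀ i, ‖2 / (Fintype.card ι : ℂ) * ∑ j, a j - a i‖ ^ 2 =
      ‖a i‖ ^ 2 + (4 / n ^ 2 * ((∑ j, (a j).re) ^ 2 + (∑ j, (a j).im) ^ 2)
        - 4 / n * ((∑ j, (a j).re) * (a i).re + (∑ j, (a j).im) * (a i).im)) := by
    intro i
    have hc : (2 / (Fintype.card ι : ℂ)) = ((2 / n : ℝ) : ℂ) := by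
      rw [hnd]; push_cast; rfl
    rw [hc, ← Complex.normSq_eq_norm_sq, ← Complex.normSq_eq_norm_sq, Complex.normSq_apply,
      Complex.normSq_apply, Complex.sub_re, Complex.sub_im, Complex.re_ofReal_mul,
      Complex.im_ofReal_mul, Complex.re_sum, Complex.im_sum]
    ring
  have hcross : ∑ i, ((∑ j, (a j).re) * (a i).re + (∑ j, (a j).im) * (a i).im) =
      (∑ j, (a j).re) * (∑ j, (a j).re) + (∑ j, (a j).im) * (∑ j, (a j).im) := by
    rw [Finset.sum_add_distrib, ← Finset.mul_sum, ← Finset.mul_sum]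
  rw [Finset.sum_congr rfl (fun i _ => key i), Finset.sum_add_distrib, Finset.sum_sub_distrib,
    ← Finset.mul_sum (s := Finset.univ) (a := 4 / n), hcross]
  simp only [Finset.sum_const, Finset.card_univ, nsmul_eq_mul]
  rw [← hnd]
  field_simp
  ring

theorem hasSum_groverAmp {ψ : G.Dart → ℂ} {S : ℝ} (h : HasSum (fun e => ‖ψ e‖ ^ 2) S) :
    HasSum (fun e => ‖groverAmp G ψ e‖ ^ 2) S := by
  let flip : G.Dart ≃ G.Dart :=
    ⟨SimpleGraph.Dart.symm, SimpleGraph.Dart.symm, SimpleGraph.Dart.symm_symm,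
      SimpleGraph.Dart.symm_symm⟩
  have h1 := (arcEquiv G).hasSum_iff.mpr h
  have hfib : ∀ v : V, ∑ w : G.neighborSet v,
      ‖groverAmp G ψ (G.dartOfNeighborSet v w).symm‖ ^ 2 =
        ∑ w : G.neighborSet v, ‖ψ (G.dartOfNeighborSet v w)‖ ^ 2 := by
    intro v
    simp only [groverAmp_symm]
    rw [← G.card_neighborSet_eq_degree v]
    exact sum_sq_reflection fun w => ψ (G.dartOfNeighborSet v w)
  have h2 : HasSum (fun v : V => ∑ w : G.neighborSet v, ‖ψ (G.dartOfNeighborSet v w)‖ ^ 2) S :=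
    h1.sigma fun v => hasSum_fintype _
  have h3 : HasSum (((fun e => ‖groverAmp G ψ e‖ ^ 2) ∘ flip) ∘ arcEquiv G) S := by
    refine HasSum.sigma_of_hasSum (g := fun v => ∑ w : G.neighborSet v,
      ‖groverAmp G ψ (G.dartOfNeighborSet v w).symm‖ ^ 2) ?_ ?_ ?_
    · simpa only [hfib] using h2
    · intro v
      exact hasSum_fintype _
    · rw [summable_sigma_of_nonneg (fun _ => by simp only [Function.comp]; positivity)]
      refine ⟨fun v => (hasSum_fintype _).summable, ?_⟩
      have h4 : ∀ v : V, ∑' w : G.neighborSet v,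
          (((fun e => ‖groverAmp G ψ e‖ ^ 2) ∘ flip) ∘ arcEquiv G) ⟨v, w⟩ =
          ∑ w : G.neighborSet v, ‖ψ (G.dartOfNeighborSet v w)‖ ^ 2 := by
        intro v
        rw [tsum_fintype]
        exact hfib v
      simp only [h4]
      exact h2.summable
  exact flip.hasSum_iff.mp ((arcEquiv G).hasSum_iff.mp h3)

theorem hasSum_norm_sq {ι : Type*} (ψ : lp (fun _ : ι => ℂ) 2) : HasSum (fun e => ‖ψ e‖ ^ 2) (‖ψ‖ ^ 2) := by
  simpa using lp.hasSum_norm (p := 2) (by norm_num) ψ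

theorem memℓp_groverAmp (ψ : ArcSpace G) : Memℓp (groverAmp G ψ) 2 := by
  rw [memℓp_gen_iff (by norm_num)]
  simpa using (hasSum_groverAmp G (hasSum_norm_sq ψ)).summable

/-- The time evolution `U` of the Grover walk, a norm preserving operator on `ℓ²(A(G))`. -/
noncomputable def groverWalk : ArcSpace G →ₗᵢ[ℂ] ArcSpace G where
  toFun ψ := ⟨groverAmp G ψ, memℓp_groverAmp G ψ⟩
  map_add' ψ φ := by
    ext f
    change groverAmp G (ψ + φ) f = groverAmp G ψ f + groverAmp G φ f
    simp [groverAmp, mul_add, Finset.sum_add_distrib]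
  map_smul' c ψ := by
    ext f
    change groverAmp G (c • ψ) f = c * groverAmp G ψ f
    simp [groverAmp, Finset.mul_sum, mul_left_comm]
  norm_map' ψ := by
    have h := (hasSum_norm_sq ⟨groverAmp G ψ, memℓp_groverAmp G ψ⟩).unique
      (hasSum_groverAmp G (hasSum_norm_sq ψ))
    exact (sq_eq_sq₀ (norm_nonneg _) (norm_nonneg _)).mp h

/-- The basis state `δ_e`. -/
noncomputable def arcState (e : G.Dart) : ArcSpace G := lp.single 2 e 1

/-- The matrix of `groverWalk` in the standard basis is the prescribed one. -/
theorem inner_groverWalk (e f : G.Dart) :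
    inner ℂ (arcState G f) (groverWalk G (arcState G e)) = groverCoeff G e f := by
  rw [arcState, lp.inner_single_left]
  change inner ℂ (1 : ℂ) (groverAmp G (arcState G e) f) = _
  rw [groverAmp]
  by_cases h : e.fst = f.snd
  · obtain ⟨w, hw⟩ : ∃ w : G.neighborSet f.snd, G.dartOfNeighborSet f.snd w = e := by
      refine ⟨⟨e.snd, h ▸ e.adj⟩, ?_⟩
      ext
      · exact h.symm
      · rfl
    rw [Finset.sum_eq_single w]
    · simp [hw, arcState]
    · intro x _ hx
      have : G.dartOfNeighborSet f.snd x ≠ e := by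
        rw [← hw]
        exact fun h' => hx (G.dartOfNeighborSet_injective _ h')
      simp [arcState, this]
    · simp
  · rw [Finset.sum_eq_zero]
    · simp [groverCoeff, h]
    · intro x _
      have : G.dartOfNeighborSet f.snd x ≠ e := by
        rintro rfl
        exact h rfl
      simp [arcState, this]

/-- The finding probability `μ_t(v) = ∑_{e : o(e) = v} |Ψ_t(e)|²` at the vertex `v`, where
`Ψ_t = U^t Ψ₀`. -/
noncomputable def vertexProb (Ψ₀ : ArcSpace G) (t : ℕ) (v : V) : ℝ :=
  ∑ w : G.neighborSet v, ‖((groverWalk G)^[t] Ψ₀) (G.dartOfNeighborSet v w)‖ ^ 2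

end Grover

/-! ### The chain of 4-cycles -/

/-- The vertices `0, u, 0', d` of the 4-cycle, in cyclic order. -/
inductive C4Vertex
  | zero
  | u
  | zeroPrime
  | d
  deriving DecidableEq

instance : Fintype C4Vertex where
  elems := {.zero, .u, .zeroPrime, .d}
  complete := by rintro (_ | _ | _ | _) <;> decide

/-- The edges `{0_j, u_j}, {u_j, 0'_j}, {0'_j, d_j}, {d_j, 0_j}` of the `j`-th copy of the
4-cycle and the bridge `{0_j, 0'_{j+1}}`, each listed in one of its two directions. -/
def chainEdge (p q : ℤ × C4Vertex) : Prop :=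
  (q.1 = p.1 ∧
    ((p.2 = .zero ∧ q.2 = .u) ∨ (p.2 = .u ∧ q.2 = .zeroPrime) ∨
      (p.2 = .zeroPrime ∧ q.2 = .d) ∨ (p.2 = .d ∧ q.2 = .zero))) ∨
  (q.1 = p.1 + 1 ∧ p.2 = .zero ∧ q.2 = .zeroPrime)

instance : DecidableRel chainEdge := fun _ _ => by unfold chainEdge; infer_instance

/-- The infinite graph made of copies of the 4-cycle labelled by `j ∈ ℤ`, consecutive copies
being joined by a bridge. The vertex `(j, v)` is the vertex `v` of the `j`-th copy. -/
def chainGraph : SimpleGraph (ℤ × C4Vertex) := SimpleGraph.fromRel chainEdge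

instance : DecidableRel chainGraph.Adj := fun p q =>
  inferInstanceAs (Decidable (p ≠ q ∧ (chainEdge p q ∨ chainEdge q p)))

instance : chainGraph.LocallyFinite := fun p =>
  Fintype.ofFinset
    ((({p.1 - 1, p.1, p.1 + 1} : Finset ℤ) ×ˢ Finset.univ).filter fun q => chainGraph.Adj p q) (by
      intro q
      simp only [Finset.mem_filter, Finset.mem_product, Finset.mem_insert,
        Finset.mem_singleton, Finset.mem_univ,
        and_true, SimpleGraph.mem_neighborSet, and_iff_right_iff_imp]
      rintro ⟨-, h | h⟩ <;> rcases h with ⟨h, -⟩ | ⟨h, -⟩ <;> omega)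

/-- The arcs whose origin lies in the `j`-th copy of the 4-cycle. -/
def cellArcs (j : ℤ) : Finset chainGraph.Dart :=
  Finset.univ.biUnion fun v : C4Vertex =>
    Finset.univ.image fun w : chainGraph.neighborSet (j, v) =>
      chainGraph.dartOfNeighborSet (j, v) w

theorem mem_cellArcs (j : ℤ) (e : chainGraph.Dart) : e ∈ cellArcs j ↔ e.fst.1 = j := by
  simp only [cellArcs, Finset.mem_biUnion, Finset.mem_univ, true_and, Finset.mem_image]
  constructor
  · rintro ⟨v, w, rfl⟩
    rfl
  · rintro rfl
    exact ⟨e.fst.2, ⟨e.snd, e.adj⟩, rfl⟩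

theorem card_cellArcs_zero : (cellArcs 0).card = 10 := by decide +kernel

/-- The law of the position `X_t` (the label of the copy of the 4-cycle) for the initial state
`Ψ₀`: `P(X_t = j) = ∑_{v ∈ {0, u, 0', d}} μ_t(j, v)`. -/
noncomputable def positionLaw (Ψ₀ : ArcSpace chainGraph) (t : ℕ) : Measure ℤ :=
  Measure.sum fun j : ℤ =>
    ENNReal.ofReal (∑ v : C4Vertex, vertexProb chainGraph Ψ₀ t (j, v)) • Measure.dirac j

/-- The law of `X_t` when the initial state is chosen uniformly from the ten basis states `δ_e`
with `o(e)` in the copy of the 4-cycle labelled `0`. -/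
noncomputable def averagedLaw (t : ℕ) : Measure ℤ :=
  (1 / 10 : ℝ≥0∞) • ∑ e ∈ cellArcs 0, positionLaw (arcState chainGraph e) t

/-! ### Dispersion relation and group velocities -/

/-- `ξ_j(k) = (1/3) arccos(A cos k) + 2jπ/3`, where `A = 9√3 / (7√7)`. -/
noncomputable def cubicAngle (j : ℕ) (k : ℝ) : ℝ :=
  1 / 3 * Real.arccos (9 * √3 / (7 * √7) * Real.cos k) + 2 * j * Real.pi / 3

/-- The solutions `λ_j(k)`, `j = 0, 1, 2`, of `9 λ³ - 7 λ - 2 cos k = 0`. -/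
noncomputable def cubicRoot (j : ℕ) (k : ℝ) : ℝ :=
  2 * √7 / (3 * √3) * Real.cos (cubicAngle j k)

/-- `ν_{j,l}(k) = λ_j(k) + (-1)^l i √(1 - λ_j(k)²)`, a point of the unit circle. -/
noncomputable def walkEigenvalue (j l : ℕ) (k : ℝ) : ℂ :=
  (cubicRoot j k : ℂ) + (-1) ^ l * Complex.I * (√(1 - cubicRoot j k ^ 2) : ℝ)

/-- `x_{j,l}(k) = i ν'_{j,l}(k) / ν_{j,l}(k)`. Where `ν_{j,l}` is differentiable this number is
real, because `ν_{j,l}` takes values in the unit circle. -/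
noncomputable def groupVelocity (j l : ℕ) (k : ℝ) : ℝ :=
  (Complex.I * deriv (walkEigenvalue j l) k / walkEigenvalue j l k).re

/-! ### The roots of the cubic -/

/-! The walk commutes with translations of the chain, so the Fourier transform in the cell index
turns it into multiplication by a unitary 10×10 matrix M(k), `walkSymbol`. By Parseval, the
characteristic function of X_t/t, averaged over the ten initial arcs, equals (1/20π) ∫ tr((M(k)^t)*
M(k - ξ/t)^t) dk over a period (`charFun_rescaledLaw`).

The spectrum of M(k) is explicit. An eigenfunction, with eigenvalue x, of the k-twisted random walk
on the four vertices lifts to eigenvectors of M(k) with eigenvalues ν satisfying ν + ν⁻¹ = 2x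
(`walkSymbol_mulVec_bandVector`). The three roots λ_j of the cubic give six bands and x = 0 gives
±i; flows around the 4-cycle supply ±1. If sin k cos k ≠ 0, the ten eigenvalues are distinct, the
eigenbases at k and k - ξ/t align as t → ∞, and the trace tends to the sum of exp(iξ x_i(k)) with
x_i = iν_i'/ν_i (`tendsto_trace_conj_pow_mul_pow`).

The four constant eigenvalues have velocity 0 and produce the atom 4/10. The symmetries k ↦ -k and k
↦ k + π reduce the six bands to two branches on which the velocity is strictly increasing;
substituting y = x(k) there produces the density 1/(3π|x'|) (`integral_bandDensity_smul`). Since x²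
is a rational function of λ² that is inverted by a quadratic equation (`bandParam_bandVelocity`),
the densities are explicit functions of y. They blow up at the edges, which correspond to λ = 1 and
λ = 0, because the closed form of x' vanishes there.

Lévy's continuity theorem then gives weak convergence, hence convergence of distribution functions
at every x ≠ 0. At the atom more is needed: the eigenvectors for ±i and ±1 do not depend on k, which
forces P(X_t = 0) ≥ 2/5 for every t (`two_fifths_le_cellProb`), so none of the atom's mass can be
approached from the right of 0. -/

theorem abs_cubicArg_lt_one (k : ℝ) : |9 * √3 / (7 * √7) * Real.cos k| < 1 := by
  have h7 : 0 < √7 := by positivity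
  have hA : 9 * √3 / (7 * √7) < 1 := by
    rw [div_lt_one (by positivity)]
    refine lt_of_pow_lt_pow_left₀ 2 (by positivity) ?_
    rw [mul_pow, mul_pow, Real.sq_sqrt (by norm_num), Real.sq_sqrt (by norm_num)]
    norm_num
  rw [abs_mul, abs_of_pos (by positivity)]
  have h0 : 0 < 9 * √3 / (7 * √7) := by positivity
  nlinarith [Real.abs_cos_le_one k, abs_nonneg (Real.cos k)]

theorem cubicScale_sq : (2 * √7 / (3 * √3)) ^ 2 = 28 / 27 := by
  rw [div_pow, mul_pow, mul_pow, Real.sq_sqrt (by norm_num), Real.sq_sqrt (by norm_num)]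
  norm_num

/-- Viète's trigonometric solution: the scale R satisfies R² = 28/27, which turns the cubic into the
triple angle formula for the cosine. -/
theorem cubicRoot_cubic (j : ℕ) (k : ℝ) :
    9 * cubicRoot j k ^ 3 - 7 * cubicRoot j k = 2 * Real.cos k := by
  have h := abs_lt.1 (abs_cubicArg_lt_one k)
  have h3 : Real.cos (3 * cubicAngle j k) = 9 * √3 / (7 * √7) * Real.cos k := by
    have : 3 * cubicAngle j k =
        Real.arccos (9 * √3 / (7 * √7) * Real.cos k) + j * (2 * Real.pi) := by
      rw [cubicAngle]; ring
    rw [this, Real.cos_add_nat_mul_two_pi, Real.cos_arccos h.1.le h.2.le]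
  rw [Real.cos_three_mul] at h3
  have hRA : 2 * √7 / (3 * √3) * (9 * √3 / (7 * √7)) = 6 / 7 := by
    field_simp
    norm_num
  have hR := cubicScale_sq
  rw [cubicRoot]
  set R := 2 * √7 / (3 * √3)
  set C := Real.cos (cubicAngle j k)
  linear_combination 9 * R * C ^ 3 * hR + 7 / 3 * R * h3 + 7 / 3 * Real.cos k * hRA

theorem four_mul_sin_sq (j : ℕ) (k : ℝ) :
    4 * Real.sin k ^ 2 =
      (1 - cubicRoot j k ^ 2) * ((1 - 9 * cubicRoot j k ^ 2) * (4 - 9 * cubicRoot j k ^ 2)) := by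
  have h := cubicRoot_cubic j k
  have := Real.sin_sq_add_cos_sq k
  linear_combination 4 * this + (9 * cubicRoot j k ^ 3 - 7 * cubicRoot j k + 2 * Real.cos k) * h

/-- At cos k = 1 the cubic has the roots 1, -1/3, -2/3, and at cos k = -1 their negatives. These
factorisations locate the ranges of the bands through the signs of 1 ∓ cos k. -/
theorem cubicRoot_cos_sub (j : ℕ) (k : ℝ) :
    (1 - cubicRoot j k) * ((3 * cubicRoot j k + 1) * (3 * cubicRoot j k + 2)) =
      2 * (1 - Real.cos k) := by
  linear_combination - cubicRoot_cubic j k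

theorem cubicRoot_cos_add (j : ℕ) (k : ℝ) :
    (1 + cubicRoot j k) * ((1 - 3 * cubicRoot j k) * (2 - 3 * cubicRoot j k)) =
      2 * (1 + Real.cos k) := by
  linear_combination cubicRoot_cubic j k

theorem cubicRoot_add_two_pi (j : ℕ) (k : ℝ) : cubicRoot j (k + 2 * Real.pi) = cubicRoot j k := by
  simp [cubicRoot, cubicAngle]

theorem cubicRoot_neg (j : ℕ) (k : ℝ) : cubicRoot j (-k) = cubicRoot j k := by
  simp [cubicRoot, cubicAngle]

/-- The shift k ↦ k + π negates cos k and hence the set of roots. It exchanges bands 0 and 1 up to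
sign and maps band 2 to its own negative, so only bands 0 and 2 need separate study. -/
theorem cubicRoot_one (k : ℝ) : cubicRoot 1 k = - cubicRoot 0 (k + Real.pi) := by
  rw [cubicRoot, cubicRoot, ← mul_neg, cubicAngle, cubicAngle, ← Real.cos_pi_sub, Real.cos_add_pi,
    mul_neg, Real.arccos_neg]
  congr 2
  push_cast
  ring

theorem cubicRoot_two_add_pi (k : ℝ) : cubicRoot 2 (k + Real.pi) = - cubicRoot 2 k := by
  have h : cubicAngle 2 (k + Real.pi) =
      -(cubicAngle 2 k + Real.pi) + (2 : ℕ) * (2 * Real.pi) := by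
    rw [cubicAngle, cubicAngle, Real.cos_add_pi k, mul_neg, Real.arccos_neg]
    push_cast
    ring
  rw [cubicRoot, cubicRoot, ← mul_neg, h, Real.cos_add_nat_mul_two_pi, Real.cos_neg,
    Real.cos_add_pi]

/-- The derivative of the cubic is 27λ² - 7, and the scale factor is twice the modulus √(7/27) of
its critical points. Being beyond the critical point therefore means that the cosine of the angle
exceeds 1/2, that is, the angle is below π/3. -/
theorem cubicRoot_zero_pos (k : ℝ) : 0 < cubicRoot 0 k ∧ 7 < 27 * cubicRoot 0 k ^ 2 := by
  have h := abs_lt.1 (abs_cubicArg_lt_one k)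
  have h1 : Real.arccos (9 * √3 / (7 * √7) * Real.cos k) < Real.pi := by
    rw [← Real.arccos_neg_one]
    exact Real.arccos_lt_arccos le_rfl h.1 h.2.le
  have h0 := Real.arccos_nonneg (9 * √3 / (7 * √7) * Real.cos k)
  have hA : cubicAngle 0 k = Real.arccos (9 * √3 / (7 * √7) * Real.cos k) / 3 := by
    rw [cubicAngle]; push_cast; ring
  have hc : 1 / 2 < Real.cos (cubicAngle 0 k) := by
    rw [← Real.cos_pi_div_three, hA]
    refine Real.cos_lt_cos_of_nonneg_of_le_pi ?_ ?_ ?_ <;> linarith [Real.pi_pos]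
  have hR := cubicScale_sq
  have hR0 : 0 < 2 * √7 / (3 * √3) := by positivity
  rw [cubicRoot]
  refine ⟨by positivity, ?_⟩
  rw [mul_pow, hR]
  nlinarith

theorem cubicRoot_two_small (k : ℝ) : 27 * cubicRoot 2 k ^ 2 < 7 := by
  have h := abs_lt.1 (abs_cubicArg_lt_one k)
  have h1 : Real.arccos (9 * √3 / (7 * √7) * Real.cos k) < Real.pi := by
    rw [← Real.arccos_neg_one]
    exact Real.arccos_lt_arccos le_rfl h.1 h.2.le
  have h0 : 0 < Real.arccos (9 * √3 / (7 * √7) * Real.cos k) := Real.arccos_pos.2 h.2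
  have hA : cubicAngle 2 k =
      (Real.arccos (9 * √3 / (7 * √7) * Real.cos k) / 3 + Real.pi / 3) + Real.pi := by
    rw [cubicAngle]; push_cast; ring
  have hc : -(1 / 2) < Real.cos (Real.arccos (9 * √3 / (7 * √7) * Real.cos k) / 3 + Real.pi / 3) := by
    rw [← Real.cos_pi_div_three, ← Real.cos_pi_sub]
    refine Real.cos_lt_cos_of_nonneg_of_le_pi ?_ ?_ ?_ <;> linarith [Real.pi_pos]
  have hc' : Real.cos (Real.arccos (9 * √3 / (7 * √7) * Real.cos k) / 3 + Real.pi / 3) < 1 / 2 := by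
    rw [← Real.cos_pi_div_three]
    refine Real.cos_lt_cos_of_nonneg_of_le_pi ?_ ?_ ?_ <;> linarith [Real.pi_pos]
  rw [cubicRoot, mul_pow, cubicScale_sq, hA, Real.cos_add_pi]
  nlinarith

theorem cubicRoot_zero_mem (k : ℝ) : 2 / 3 ≤ cubicRoot 0 k ∧ cubicRoot 0 k ≤ 1 := by
  obtain ⟨h0, h1⟩ := cubicRoot_zero_pos k
  have h2 := cubicRoot_cos_sub 0 k
  have h3 := cubicRoot_cos_add 0 k
  have := Real.cos_le_one k
  have := Real.neg_one_le_cos k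
  set l := cubicRoot 0 k
  have h4 : 1 / 3 < l := by nlinarith
  constructor
  · by_contra! h
    have : 0 < (1 + l) * ((3 * l - 1) * (2 - 3 * l)) := by
      refine mul_pos (by linarith) (mul_pos (by linarith) (by linarith))
    linarith
  · by_contra! h
    have : 0 < (l - 1) * ((3 * l + 1) * (3 * l + 2)) := by
      refine mul_pos (by linarith) (by positivity)
    linarith

theorem cubicRoot_two_mem (k : ℝ) : -(1 / 3) ≤ cubicRoot 2 k ∧ cubicRoot 2 k ≤ 1 / 3 := by
  have h1 := cubicRoot_two_small k
  have h2 := cubicRoot_cos_sub 2 k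
  have h3 := cubicRoot_cos_add 2 k
  have := Real.cos_le_one k
  have := Real.neg_one_le_cos k
  set l := cubicRoot 2 k
  have h4 : l < 2 / 3 := by nlinarith
  have h5 : -(2 / 3) < l := by nlinarith
  constructor
  · by_contra! h
    have : 0 < (1 - l) * ((-1 - 3 * l) * (3 * l + 2)) := by
      refine mul_pos (by linarith) (mul_pos (by linarith) (by linarith))
    linarith
  · by_contra! h
    have : 0 < (1 + l) * ((3 * l - 1) * (2 - 3 * l)) := by
      refine mul_pos (by linarith) (mul_pos (by linarith) (by linarith))
    linarith

theorem cubicRoot_disc_ne_zero {j : ℕ} (hj : j < 3) (k : ℝ) : 27 * cubicRoot j k ^ 2 - 7 ≠ 0 := by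
  interval_cases j
  · linarith [(cubicRoot_zero_pos k).2]
  · rw [cubicRoot_one]
    linarith [(cubicRoot_zero_pos (k + Real.pi)).2]
  · linarith [cubicRoot_two_small k]

/-- Differentiability comes from the arccos formula, away from its endpoints; the value comes from
differentiating the cubic implicitly. -/
theorem hasDerivAt_cubicRoot {j : ℕ} (hj : j < 3) (k : ℝ) :
    HasDerivAt (cubicRoot j) (-(2 * Real.sin k) / (27 * cubicRoot j k ^ 2 - 7)) k := by
  have h := abs_lt.1 (abs_cubicArg_lt_one k)
  have hd : DifferentiableAt ℝ (cubicRoot j) k := by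
    have h1 : DifferentiableAt ℝ
        (fun k => Real.arccos (9 * √3 / (7 * √7) * Real.cos k)) k :=
      (Real.differentiableAt_arccos.2 ⟨h.1.ne', h.2.ne⟩).comp
        (f := fun k => 9 * √3 / (7 * √7) * Real.cos k) k (by fun_prop)
    unfold cubicRoot cubicAngle
    fun_prop
  have h1 := (((hd.hasDerivAt.pow 3).const_mul 9).sub (hd.hasDerivAt.const_mul 7))
  have h2 : HasDerivAt (fun k => 9 * cubicRoot j k ^ 3 - 7 * cubicRoot j k)
      (2 * -Real.sin k) k := by
    simp only [cubicRoot_cubic]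
    exact (Real.hasDerivAt_cos k).const_mul 2
  have h3 := h1.unique h2
  convert! hd.hasDerivAt using 1
  rw [div_eq_iff (cubicRoot_disc_ne_zero hj k)]
  push_cast at h3
  linear_combination -h3

theorem continuous_cubicRoot {j : ℕ} (hj : j < 3) : Continuous (cubicRoot j) :=
  continuous_iff_continuousAt.2 fun k => (hasDerivAt_cubicRoot hj k).continuousAt

/-! ### Group velocities -/

/-- The group velocity of the `j`-th band of the walk, in closed form. -/
noncomputable def bandVelocity (j : ℕ) (k : ℝ) : ℝ :=
  -(2 * Real.sin k) / ((27 * cubicRoot j k ^ 2 - 7) * √(1 - cubicRoot j k ^ 2))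

/-- The derivative of `bandVelocity`, in closed form. -/
noncomputable def bandAcceleration (j : ℕ) (k : ℝ) : ℝ :=
  9 * (9 * cubicRoot j k ^ 2 + 11) * cubicRoot j k * √(1 - cubicRoot j k ^ 2) /
    (27 * cubicRoot j k ^ 2 - 7) ^ 3

theorem hasDerivAt_sqrt_one_sub_cubicRoot_sq {j : ℕ} (hj : j < 3) {k : ℝ}
    (hl : cubicRoot j k ^ 2 < 1) :
    HasDerivAt (fun k => √(1 - cubicRoot j k ^ 2)) (-(cubicRoot j k * bandVelocity j k)) k := by
  have hq : 0 < √(1 - cubicRoot j k ^ 2) := Real.sqrt_pos.2 (by linarith)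
  have hD := cubicRoot_disc_ne_zero hj k
  have h := (((hasDerivAt_cubicRoot hj k).pow 2).const_sub 1).sqrt (by simp only [Pi.pow_apply]; linarith)
  convert! h using 1
  rw [bandVelocity]
  simp only [Pi.pow_apply]
  field_simp
  push_cast
  ring

theorem walkEigenvalue_mul_conj {j l : ℕ} {k : ℝ} (hl : cubicRoot j k ^ 2 ≤ 1) :
    walkEigenvalue j l k * (starRingEnd ℂ) (walkEigenvalue j l k) = 1 := by
  have hq : ((√(1 - cubicRoot j k ^ 2) : ℝ) : ℂ) ^ 2 = 1 - (cubicRoot j k : ℂ) ^ 2 := by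
    rw [← Complex.ofReal_pow, Real.sq_sqrt (by linarith)]
    push_cast
    ring
  have hs : ((-1 : ℂ) ^ l) ^ 2 = 1 := by rw [← pow_mul, mul_comm, pow_mul]; simp
  simp only [walkEigenvalue, map_add, map_mul, map_pow, map_neg, map_one, Complex.conj_I,
    Complex.conj_ofReal]
  linear_combination (((√(1 - cubicRoot j k ^ 2) : ℝ) : ℂ) ^ 2 * hs + hq) -
    (((-1 : ℂ) ^ l) ^ 2) * ((√(1 - cubicRoot j k ^ 2) : ℝ) : ℂ) ^ 2 * Complex.I_sq

theorem hasDerivAt_walkEigenvalue {j : ℕ} (hj : j < 3) (l : ℕ) {k : ℝ}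
    (hl : cubicRoot j k ^ 2 < 1) :
    HasDerivAt (walkEigenvalue j l)
      (-(Complex.I * (-1) ^ l * bandVelocity j k * walkEigenvalue j l k)) k := by
  have hq : (√(1 - cubicRoot j k ^ 2) : ℝ) ≠ 0 := (Real.sqrt_pos.2 (by linarith)).ne'
  have hD := cubicRoot_disc_ne_zero hj k
  have h1 := (hasDerivAt_cubicRoot hj k).ofReal_comp
  have h2 := (hasDerivAt_sqrt_one_sub_cubicRoot_sq hj hl).ofReal_comp
  have h3 : -(2 * Real.sin k) / (27 * cubicRoot j k ^ 2 - 7) =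
      bandVelocity j k * √(1 - cubicRoot j k ^ 2) := by
    rw [bandVelocity]
    field_simp
  have hs : ((-1 : ℂ) ^ l) ^ 2 = 1 := by rw [← pow_mul, mul_comm, pow_mul]; simp
  rw [h3] at h1
  have h4 := h1.add (h2.const_mul ((-1) ^ l * Complex.I))
  convert! h4 using 1
  rw [walkEigenvalue]
  push_cast
  linear_combination (bandVelocity j k * (√(1 - cubicRoot j k ^ 2) : ℝ) : ℂ) *
    (hs - ((-1 : ℂ) ^ l) ^ 2 * Complex.I_sq)

theorem groupVelocity_eq {j : ℕ} (hj : j < 3) (l : ℕ) {k : ℝ} (hl : cubicRoot j k ^ 2 < 1) :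
    groupVelocity j l k = (-1) ^ l * bandVelocity j k := by
  have h0 : walkEigenvalue j l k ≠ 0 :=
    left_ne_zero_of_mul_eq_one (walkEigenvalue_mul_conj hl.le)
  rw [groupVelocity, (hasDerivAt_walkEigenvalue hj l hl).deriv]
  have : Complex.I * -(Complex.I * (-1) ^ l * bandVelocity j k * walkEigenvalue j l k) /
      walkEigenvalue j l k = (((-1) ^ l * bandVelocity j k : ℝ) : ℂ) := by
    rw [div_eq_iff h0]
    push_cast
    linear_combination (-((-1) ^ l * bandVelocity j k * walkEigenvalue j l k)) * Complex.I_sq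
  rw [this, Complex.ofReal_re]

theorem hasDerivAt_bandVelocity {j : ℕ} (hj : j < 3) {k : ℝ} (hl : cubicRoot j k ^ 2 < 1) :
    HasDerivAt (bandVelocity j) (bandAcceleration j k) k := by
  have hq : (√(1 - cubicRoot j k ^ 2) : ℝ) ≠ 0 := (Real.sqrt_pos.2 (by linarith)).ne'
  have hq2 : (√(1 - cubicRoot j k ^ 2) : ℝ) ^ 2 = 1 - cubicRoot j k ^ 2 :=
    Real.sq_sqrt (by linarith)
  have hD := cubicRoot_disc_ne_zero hj k
  have h1 := hasDerivAt_cubicRoot hj k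
  have h2 := hasDerivAt_sqrt_one_sub_cubicRoot_sq hj hl
  have h3 := ((Real.hasDerivAt_sin k).const_mul 2).neg.div
    ((((h1.pow 2).const_mul 27).sub_const 7).mul h2) (by simpa using ⟨hD, hq⟩)
  convert! h3 using 1
  have hs := four_mul_sin_sq j k
  have hc := cubicRoot_cubic j k
  simp only [bandAcceleration, bandVelocity, Pi.mul_apply, Pi.pow_apply]
  set x := cubicRoot j k
  set q := √(1 - x ^ 2)
  have hq4 : q ^ 4 = (1 - x ^ 2) ^ 2 := by rw [← hq2]; ring
  simp only [Pi.neg_apply]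
  field_simp
  have hD' : x ^ 2 * 27 - 7 ≠ 0 := by rwa [mul_comm]
  field_simp
  rw [hq4, hq2]
  push_cast
  -- The cubic eliminates cos k and the factorisation of 4 sin² k eliminates sin² k, which leaves an
  -- expression in the root alone.
  linear_combination (-(1 - x ^ 2) * (27 * x ^ 2 - 7) ^ 2) * hc +
    (54 * (1 - x ^ 2) * x - x * (27 * x ^ 2 - 7)) * hs

/-- The factor 1 - λ² of 4 sin² k cancels against the square root. The resulting rational function
stays finite at λ = 1, with value 1/10, and equals 4/49 at λ = 0; these are the squares of the two
edges. -/
theorem bandVelocity_sq {j : ℕ} {k : ℝ} (hl : cubicRoot j k ^ 2 < 1) :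
    bandVelocity j k ^ 2 = (1 - 9 * cubicRoot j k ^ 2) * (4 - 9 * cubicRoot j k ^ 2) /
      (27 * cubicRoot j k ^ 2 - 7) ^ 2 := by
  have h : 1 - cubicRoot j k ^ 2 ≠ 0 := by linarith
  rw [bandVelocity, div_pow, mul_pow, Real.sq_sqrt (by linarith), neg_sq, mul_pow,
    show (2 : ℝ) ^ 2 = 4 by norm_num, four_mul_sin_sq j k, mul_comm (1 - cubicRoot j k ^ 2),
    mul_div_mul_right _ _ h]

theorem cubicRoot_zero_sq_lt_one {k : ℝ} (hk : Real.cos k ≠ 1) : cubicRoot 0 k ^ 2 < 1 := by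
  obtain ⟨h1, h2⟩ := cubicRoot_zero_mem k
  have h : cubicRoot 0 k ≠ 1 := by
    intro h
    have := cubicRoot_cos_sub 0 k
    rw [h] at this
    exact hk (by linarith)
  have := lt_of_le_of_ne h2 h
  nlinarith

theorem cubicRoot_two_sq_lt_one (k : ℝ) : cubicRoot 2 k ^ 2 < 1 := by
  linarith [cubicRoot_two_small k]

theorem cos_ne_one_of_mem_Ioo {k : ℝ} (hk : k ∈ Ioo 0 (2 * Real.pi)) : Real.cos k ≠ 1 := by
  intro h
  have := (Real.cos_eq_one_iff_of_lt_of_lt (by linarith [hk.1, Real.pi_pos]) hk.2).1 h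
  exact hk.1.ne' this

theorem bandAcceleration_zero_pos {k : ℝ} (hk : Real.cos k ≠ 1) : 0 < bandAcceleration 0 k := by
  have h1 := cubicRoot_zero_sq_lt_one hk
  obtain ⟨h0, h2⟩ := cubicRoot_zero_pos k
  have hq : 0 < √(1 - cubicRoot 0 k ^ 2) := Real.sqrt_pos.2 (by linarith)
  have hD : 0 < 27 * cubicRoot 0 k ^ 2 - 7 := by linarith
  rw [bandAcceleration]
  positivity

theorem cubicRoot_two_neg {k : ℝ} (hk : 0 < Real.cos k) : cubicRoot 2 k < 0 := by
  have h1 := cubicRoot_two_small k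
  have h2 := cubicRoot_cubic 2 k
  by_contra! h
  nlinarith [mul_nonneg h (show 0 ≤ 7 - 9 * cubicRoot 2 k ^ 2 by nlinarith)]

theorem bandAcceleration_two_pos {k : ℝ} (hk : 0 < Real.cos k) : 0 < bandAcceleration 2 k := by
  have h1 := cubicRoot_two_sq_lt_one k
  have h0 := cubicRoot_two_neg hk
  have h2 := cubicRoot_two_small k
  have hq : 0 < √(1 - cubicRoot 2 k ^ 2) := Real.sqrt_pos.2 (by linarith)
  have hD : 0 < (7 - 27 * cubicRoot 2 k ^ 2) := by linarith
  rw [bandAcceleration, ← neg_div_neg_eq]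
  refine div_pos ?_ ?_
  · have : 0 < 9 * (9 * cubicRoot 2 k ^ 2 + 11) * (-cubicRoot 2 k) * √(1 - cubicRoot 2 k ^ 2) := by
      have : 0 < - cubicRoot 2 k := by linarith
      positivity
    linarith
  · have : 0 < (7 - 27 * cubicRoot 2 k ^ 2) ^ 3 := by positivity
    linarith [show (7 - 27 * cubicRoot 2 k ^ 2) ^ 3 = -(27 * cubicRoot 2 k ^ 2 - 7) ^ 3 by ring]

theorem hasDerivAt_groupVelocity {j : ℕ} (hj : j < 3) {k : ℝ} (hl : cubicRoot j k ^ 2 < 1) :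
    HasDerivAt (groupVelocity j 0) (bandAcceleration j k) k := by
  refine (hasDerivAt_bandVelocity hj hl).congr_of_eventuallyEq ?_
  have : ∀ᶠ x in 𝓝 k, cubicRoot j x ^ 2 < 1 :=
    ((continuous_cubicRoot hj).pow 2).continuousAt.eventually_lt continuousAt_const hl
  filter_upwards [this] with x hx
  simpa using groupVelocity_eq hj 0 hx

theorem bandVelocity_two_pi_sub (j : ℕ) (k : ℝ) :
    bandVelocity j (2 * Real.pi - k) = - bandVelocity j k := by
  have h : cubicRoot j (2 * Real.pi - k) = cubicRoot j k := by
    rw [← cubicRoot_neg, ← cubicRoot_add_two_pi]; congr 1; ring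
  rw [bandVelocity, bandVelocity, h, Real.sin_two_pi_sub]
  ring

theorem bandVelocity_neg (j : ℕ) (k : ℝ) :
    bandVelocity j (-k) = - bandVelocity j k := by
  rw [bandVelocity, bandVelocity, cubicRoot_neg, Real.sin_neg]
  ring

theorem bandVelocity_one (k : ℝ) : bandVelocity 1 k = -bandVelocity 0 (k + Real.pi) := by
  rw [bandVelocity, bandVelocity, cubicRoot_one, Real.sin_add_pi]
  ring_nf

theorem bandVelocity_two_add_pi (k : ℝ) : bandVelocity 2 (k + Real.pi) = -bandVelocity 2 k := by
  rw [bandVelocity, bandVelocity, cubicRoot_two_add_pi, Real.sin_add_pi]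
  ring_nf

theorem bandVelocity_add_two_pi (j : ℕ) (k : ℝ) :
    bandVelocity j (k + 2 * Real.pi) = bandVelocity j k := by
  rw [bandVelocity, bandVelocity, cubicRoot_add_two_pi, Real.sin_add_two_pi]

/-! ### The image of the group velocities -/

/-- Intermediate values: oddness about the midpoint turns values close to a into values close to -a,
so only the upper end has to be approached. -/
theorem image_Ioo_eq_of_odd {w : ℝ → ℝ} {c d a : ℝ} (hw : ContinuousOn w (Ioo c d))
    (hodd : ∀ k ∈ Ioo c d, w (c + d - k) = - w k) (hsq : ∀ k ∈ Ioo c d, |w k| < a)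
    (hsup : ∀ b < a, ∃ k ∈ Ioo c d, b < w k) : w '' Ioo c d = Ioo (-a) a := by
  apply Subset.antisymm
  · rintro _ ⟨k, hk, rfl⟩
    exact abs_lt.1 (hsq k hk)
  · intro y hy
    obtain ⟨k₁, h₁, h₁'⟩ := hsup y hy.2
    obtain ⟨k₂, h₂, h₂'⟩ := hsup (-y) (by linarith [hy.1])
    have h₃ : c + d - k₂ ∈ Ioo c d := ⟨by linarith [h₂.2], by linarith [h₂.1]⟩
    refine isPreconnected_Ioo.intermediate_value h₃ h₁ hw ⟨?_, h₁'.le⟩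
    rw [hodd k₂ h₂]
    linarith

theorem image_bandVelocity_zero :
    bandVelocity 0 '' Ioo 0 (2 * Real.pi) = Ioo (-(1 / √10)) (1 / √10) := by
  have ha : (1 / √10) ^ 2 = 1 / 10 := by rw [div_pow, Real.sq_sqrt (by norm_num)]; norm_num
  have ha0 : 0 < 1 / √10 := by positivity
  refine image_Ioo_eq_of_odd ?_ ?_ ?_ ?_
  · intro k hk
    exact (hasDerivAt_bandVelocity (by norm_num)
      (cubicRoot_zero_sq_lt_one (cos_ne_one_of_mem_Ioo hk))).continuousAt.continuousWithinAt
  · intro k _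
    rw [zero_add, bandVelocity_two_pi_sub]
  · intro k hk
    have hl := cubicRoot_zero_sq_lt_one (cos_ne_one_of_mem_Ioo hk)
    have hD := (cubicRoot_zero_pos k).2
    refine abs_lt_of_sq_lt_sq ?_ ha0.le
    rw [ha, bandVelocity_sq hl, div_lt_div_iff₀ (by nlinarith) (by norm_num)]
    -- With u = λ², (27u - 7)² - 10(1 - 9u)(4 - 9u) = 9(1 - u)(9u + 1).
    nlinarith [mul_pos (show 0 < 1 - cubicRoot 0 k ^ 2 by linarith)
      (show 0 < 9 * cubicRoot 0 k ^ 2 + 1 by positivity)]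
  · intro b hb
    have hc : Continuous fun k => (1 - 9 * cubicRoot 0 k ^ 2) * (4 - 9 * cubicRoot 0 k ^ 2) /
        (27 * cubicRoot 0 k ^ 2 - 7) ^ 2 := by
      have := continuous_cubicRoot (j := 0) (by norm_num)
      refine Continuous.div (by fun_prop) (by fun_prop) fun k => ?_
      exact pow_ne_zero _ (cubicRoot_disc_ne_zero (by norm_num) k)
    have h1 : cubicRoot 0 (2 * Real.pi) = 1 := by
      have h := cubicRoot_cos_sub 0 (2 * Real.pi)
      have h0 := (cubicRoot_zero_pos (2 * Real.pi)).1
      rw [Real.cos_two_pi, sub_self, mul_zero] at h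
      have := (mul_eq_zero.1 h).resolve_right (by positivity)
      linarith
    have h2 : (max b 0) ^ 2 < 1 / 10 := by
      rw [← ha]
      exact pow_lt_pow_left₀ (max_lt hb ha0) (le_max_right _ _) two_ne_zero
    have h3 : ∀ᶠ k in 𝓝[<] (2 * Real.pi), (max b 0) ^ 2 <
        (1 - 9 * cubicRoot 0 k ^ 2) * (4 - 9 * cubicRoot 0 k ^ 2) /
        (27 * cubicRoot 0 k ^ 2 - 7) ^ 2 := by
      refine (continuousAt_const.eventually_lt hc.continuousAt ?_).filter_mono nhdsWithin_le_nhds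
      rw [h1]
      norm_num at h2 ⊢
      exact h2
    obtain ⟨k, hk, hk'⟩ := (h3.and (Ioo_mem_nhdsLT
      (show Real.pi < 2 * Real.pi by linarith [Real.pi_pos]))).exists
    have hkm : k ∈ Ioo 0 (2 * Real.pi) := ⟨Real.pi_pos.trans hk'.1, hk'.2⟩
    have hl := cubicRoot_zero_sq_lt_one (cos_ne_one_of_mem_Ioo hkm)
    refine ⟨k, hkm, ?_⟩
    rw [← bandVelocity_sq hl] at hk
    have hpos : 0 ≤ bandVelocity 0 k := by
      have hs : Real.sin k < 0 := by
        have := Real.sin_pos_of_pos_of_lt_pi (x := k - Real.pi) (by linarith [hk'.1])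
          (by linarith [hk'.2])
        rw [Real.sin_sub_pi] at this
        linarith
      have hD := (cubicRoot_zero_pos k).2
      rw [bandVelocity]
      exact div_nonneg (by linarith) (mul_nonneg (by linarith) (Real.sqrt_nonneg _))
    exact (le_max_left _ _).trans_lt (lt_of_pow_lt_pow_left₀ 2 hpos hk)

theorem image_bandVelocity_two :
    bandVelocity 2 '' Ioo (-(Real.pi / 2)) (Real.pi / 2) = Ioo (-(2 / 7)) (2 / 7) := by
  refine image_Ioo_eq_of_odd ?_ ?_ ?_ ?_
  · intro k hk
    exact (hasDerivAt_bandVelocity (by norm_num)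
      (cubicRoot_two_sq_lt_one k)).continuousAt.continuousWithinAt
  · intro k _
    rw [neg_add_cancel, zero_sub, bandVelocity_neg]
  · intro k hk
    have hl := cubicRoot_two_sq_lt_one k
    have h0 := cubicRoot_two_neg (Real.cos_pos_of_mem_Ioo hk)
    have hD := cubicRoot_two_small k
    refine abs_lt_of_sq_lt_sq ?_ (by norm_num)
    rw [bandVelocity_sq hl, div_pow, div_lt_div_iff₀ (by nlinarith) (by norm_num)]
    -- With u = λ², 4(27u - 7)² - 49(1 - 9u)(4 - 9u) = 9u(77 - 117u).
    nlinarith [mul_pos (sq_pos_of_neg h0)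
      (show 0 < 77 - 13 * 9 * cubicRoot 2 k ^ 2 by linarith)]
  · intro b hb
    have hc : Continuous fun k => (1 - 9 * cubicRoot 2 k ^ 2) * (4 - 9 * cubicRoot 2 k ^ 2) /
        (27 * cubicRoot 2 k ^ 2 - 7) ^ 2 := by
      have := continuous_cubicRoot (j := 2) (by norm_num)
      refine Continuous.div (by fun_prop) (by fun_prop) fun k => ?_
      exact pow_ne_zero _ (cubicRoot_disc_ne_zero (by norm_num) k)
    have h1 : cubicRoot 2 (Real.pi / 2) = 0 := by
      have h := cubicRoot_cubic 2 (Real.pi / 2)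
      have h0 := cubicRoot_two_small (Real.pi / 2)
      rw [Real.cos_pi_div_two, mul_zero] at h
      have h' : cubicRoot 2 (Real.pi / 2) * (9 * cubicRoot 2 (Real.pi / 2) ^ 2 - 7) = 0 := by
        linear_combination h
      exact (mul_eq_zero.1 h').resolve_right (by nlinarith)
    have h2 : (max b 0) ^ 2 < (2 / 7) ^ 2 :=
      pow_lt_pow_left₀ (max_lt hb (by norm_num)) (le_max_right _ _) two_ne_zero
    have h3 : ∀ᶠ k in 𝓝[<] (Real.pi / 2), (max b 0) ^ 2 <
        (1 - 9 * cubicRoot 2 k ^ 2) * (4 - 9 * cubicRoot 2 k ^ 2) /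
        (27 * cubicRoot 2 k ^ 2 - 7) ^ 2 := by
      refine (continuousAt_const.eventually_lt hc.continuousAt ?_).filter_mono nhdsWithin_le_nhds
      rw [h1]
      norm_num at h2 ⊢
      exact h2
    obtain ⟨k, hk, hk'⟩ := (h3.and (Ioo_mem_nhdsLT
      (show 0 < Real.pi / 2 by linarith [Real.pi_pos]))).exists
    refine ⟨k, ⟨by linarith [hk'.1, Real.pi_pos], hk'.2⟩, ?_⟩
    rw [← bandVelocity_sq (cubicRoot_two_sq_lt_one k)] at hk
    have hpos : 0 ≤ bandVelocity 2 k := by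
      have hs : 0 < Real.sin k :=
        Real.sin_pos_of_pos_of_lt_pi hk'.1 (by linarith [hk'.2, Real.pi_pos])
      have hD := cubicRoot_two_small k
      rw [bandVelocity]
      exact div_nonneg_of_nonpos (by linarith)
        (mul_nonpos_of_nonpos_of_nonneg (by linarith) (Real.sqrt_nonneg _))
    exact (le_max_left _ _).trans_lt (lt_of_pow_lt_pow_left₀ 2 hpos hk)

/-! ### The limit densities -/

/-- The value of `9 λ²` at which the group velocity is `y`; the sign `ε` selects the band. -/
noncomputable def bandParam (ε y : ℝ) : ℝ :=
  (5 - 42 * y ^ 2 + ε * √(9 - 80 * y ^ 2)) / (2 * (1 - 9 * y ^ 2))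

/-- The density `1 / (3π |x'|)` in terms of `s = 9 λ²`. -/
noncomputable def bandShape (s : ℝ) : ℝ :=
  |3 * s - 7| ^ 3 / (3 * Real.pi * (s + 11) * √(s * (9 - s)))

/-- The limit density of a band, supported in `(-a, a)`. -/
noncomputable def bandDensity (ε a : ℝ) : ℝ → ℝ :=
  (Ioo (-a) a).indicator fun y => bandShape (bandParam ε y)

/-- With s = 9λ², the relation y²(3s - 7)² = (1 - s)(4 - s) is quadratic in s with discriminant 9 -
80y² = ((s + 11)/(3s - 7))². The sign of 3s - 7, which is constant on each band, decides which root
is s. -/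
theorem bandParam_bandVelocity {j : ℕ} (hj : j < 3) {k ε : ℝ} (hl : cubicRoot j k ^ 2 < 1)
    (hε : ε * |27 * cubicRoot j k ^ 2 - 7| = 27 * cubicRoot j k ^ 2 - 7) :
    bandParam ε (bandVelocity j k) = 9 * cubicRoot j k ^ 2 := by
  have hD := cubicRoot_disc_ne_zero hj k
  have hw := bandVelocity_sq hl
  rw [bandParam, hw]
  set x := cubicRoot j k
  have hD₂ : x ^ 2 * 27 - 7 ≠ 0 := by rwa [mul_comm]
  have h1 : 9 - 80 * ((1 - 9 * x ^ 2) * (4 - 9 * x ^ 2) / (27 * x ^ 2 - 7) ^ 2) =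
      ((9 * x ^ 2 + 11) / |27 * x ^ 2 - 7|) ^ 2 := by
    rw [div_pow, sq_abs]
    field_simp
    ring
  have h2 : 1 - 9 * ((1 - 9 * x ^ 2) * (4 - 9 * x ^ 2) / (27 * x ^ 2 - 7) ^ 2) =
      (27 * x ^ 2 + 13) / (27 * x ^ 2 - 7) ^ 2 := by
    field_simp
    ring
  have h3 : ε * ((9 * x ^ 2 + 11) / |27 * x ^ 2 - 7|) =
      (9 * x ^ 2 + 11) * (27 * x ^ 2 - 7) / (27 * x ^ 2 - 7) ^ 2 := by
    have hD' : |27 * x ^ 2 - 7| ≠ 0 := abs_ne_zero.2 hD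
    rw [← sq_abs (27 * x ^ 2 - 7), mul_div_assoc', div_eq_div_iff hD' (pow_ne_zero 2 hD')]
    linear_combination (9 * x ^ 2 + 11) * |27 * x ^ 2 - 7| * hε
  have h4 : 27 * x ^ 2 + 13 ≠ 0 := by positivity
  rw [h1, Real.sqrt_sq (by positivity), h2, h3]
  field_simp
  ring

theorem bandShape_nine_mul_sq (j : ℕ) (k : ℝ) :
    bandShape (9 * cubicRoot j k ^ 2) = 1 / (3 * Real.pi * |bandAcceleration j k|) := by
  have h1 : √(9 * cubicRoot j k ^ 2 * (9 - 9 * cubicRoot j k ^ 2)) =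
      9 * |cubicRoot j k| * √(1 - cubicRoot j k ^ 2) := by
    rw [show 9 * cubicRoot j k ^ 2 * (9 - 9 * cubicRoot j k ^ 2) =
      (9 * |cubicRoot j k|) ^ 2 * (1 - cubicRoot j k ^ 2) by rw [mul_pow, sq_abs]; ring,
      Real.sqrt_mul (by positivity), Real.sqrt_sq (by positivity)]
  rw [bandShape, bandAcceleration, abs_div, abs_pow, h1, abs_mul, abs_mul, abs_mul,
    abs_of_nonneg (Real.sqrt_nonneg _), abs_of_pos (show (0 : ℝ) < 9 by norm_num),
    abs_of_pos (show 0 < 9 * cubicRoot j k ^ 2 + 11 by positivity), ← mul_assoc, mul_div_assoc', one_div_div]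
  norm_num
  ring_nf

/-- The data needed to describe one band of the limit law: on the interval `I` of wave numbers
the group velocity increases and covers `(-a, a)`. -/
structure IsBand (j : ℕ) (c d ε a : ℝ) : Prop where
  lt_three : j < 3
  sq_lt_one : ∀ k ∈ Ioo c d, cubicRoot j k ^ 2 < 1
  acceleration_pos : ∀ k ∈ Ioo c d, 0 < bandAcceleration j k
  image_eq : bandVelocity j '' Ioo c d = Ioo (-a) a
  sign_eq : ∀ k, ε * |27 * cubicRoot j k ^ 2 - 7| = 27 * cubicRoot j k ^ 2 - 7
  one_sub_pos : 0 < 1 - 9 * a ^ 2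
  edge : bandParam ε a * (9 - bandParam ε a) = 0
  edge_pos : 0 < |3 * bandParam ε a - 7| ^ 3 / (3 * Real.pi * (bandParam ε a + 11))
  le : c ≤ d

theorem isBand_zero : IsBand 0 0 (2 * Real.pi) 1 (1 / √10) := by
  have ha : (1 / √10) ^ 2 = 1 / 10 := by rw [div_pow, Real.sq_sqrt (by norm_num)]; norm_num
  have hp : bandParam 1 (1 / √10) = 9 := by
    rw [bandParam, ha]
    norm_num
  refine ⟨by norm_num, fun k hk => cubicRoot_zero_sq_lt_one (cos_ne_one_of_mem_Ioo hk),
    fun k hk => bandAcceleration_zero_pos (cos_ne_one_of_mem_Ioo hk), image_bandVelocity_zero,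
    fun k => ?_, ?_, ?_, ?_, by positivity⟩
  · rw [one_mul, abs_of_pos]
    linarith [(cubicRoot_zero_pos k).2]
  · rw [ha]; norm_num
  · rw [hp]; norm_num
  · rw [hp]; norm_num; positivity

theorem isBand_two : IsBand 2 (-(Real.pi / 2)) (Real.pi / 2) (-1) (2 / 7) := by
  have hp : bandParam (-1) (2 / 7) = 0 := by
    rw [bandParam, show (9 : ℝ) - 80 * (2 / 7) ^ 2 = (11 / 7) ^ 2 by norm_num,
      Real.sqrt_sq (by norm_num)]
    norm_num
  refine ⟨by norm_num, fun k _ => cubicRoot_two_sq_lt_one k,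
    fun k hk => bandAcceleration_two_pos (Real.cos_pos_of_mem_Ioo hk), image_bandVelocity_two,
    fun k => ?_, ?_, ?_, ?_, by linarith [Real.pi_pos]⟩
  · rw [abs_of_neg]
    · ring
    · linarith [cubicRoot_two_small k]
  · norm_num
  · rw [hp]; norm_num
  · rw [hp]; norm_num; positivity

namespace IsBand

variable {j : ℕ} {c d ε a : ℝ}

theorem bandDensity_bandVelocity (h : IsBand j c d ε a) {k : ℝ} (hk : k ∈ Ioo c d) :
    bandDensity ε a (bandVelocity j k) = 1 / (3 * Real.pi * |bandAcceleration j k|) := by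
  have hm : bandVelocity j k ∈ Ioo (-a) a := h.image_eq ▸ mem_image_of_mem _ hk
  rw [bandDensity, indicator_of_mem hm,
    bandParam_bandVelocity h.lt_three (h.sq_lt_one k hk) (h.sign_eq k),
    bandShape_nine_mul_sq]

theorem bandDensity_pos (h : IsBand j c d ε a) {y : ℝ} (hy : y ∈ Ioo (-a) a) :
    0 < bandDensity ε a y := by
  rw [← h.image_eq] at hy
  obtain ⟨k, hk, rfl⟩ := hy
  rw [h.bandDensity_bandVelocity hk]
  have := h.acceleration_pos k hk
  positivity

theorem bandDensity_nonneg (h : IsBand j c d ε a) (y : ℝ) : 0 ≤ bandDensity ε a y := by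
  by_cases hy : y ∈ Ioo (-a) a
  · exact (h.bandDensity_pos hy).le
  · rw [bandDensity, indicator_of_notMem hy]

theorem support_bandDensity (h : IsBand j c d ε a) :
    Function.support (bandDensity ε a) = Ioo (-a) a := by
  apply Subset.antisymm
  · exact support_indicator_subset
  · exact fun y hy => (h.bandDensity_pos hy).ne'

theorem graph_bandDensity (h : IsBand j c d ε a) :
    (fun y => (y, bandDensity ε a y)) '' Ioo (-a) a =
      (fun k => (bandVelocity j k, 1 / (3 * Real.pi * |bandAcceleration j k|))) '' Ioo c d := by
  rw [← h.image_eq, image_image]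
  exact image_congr fun k hk => by rw [h.bandDensity_bandVelocity hk]

theorem bandParam_pos (h : IsBand j c d ε a) {y : ℝ} (hy : y ∈ Ioo (-a) a) :
    0 < bandParam ε y + 11 ∧ 0 < bandParam ε y * (9 - bandParam ε y) := by
  rw [← h.image_eq] at hy
  obtain ⟨k, hk, rfl⟩ := hy
  have hl := h.sq_lt_one k hk
  rw [bandParam_bandVelocity h.lt_three hl (h.sign_eq k)]
  refine ⟨by positivity, ?_⟩
  have hx : cubicRoot j k ≠ 0 := by
    intro h0
    have := h.acceleration_pos k hk
    rw [bandAcceleration, h0] at this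
    simp at this
  have : 0 < 9 - 9 * cubicRoot j k ^ 2 := by linarith
  positivity

theorem continuousAt_bandParam (h : IsBand j c d ε a) {y : ℝ} (hy : y ∈ Icc (-a) a) :
    ContinuousAt (bandParam ε) y := by
  have h0 : y ^ 2 ≤ a ^ 2 := sq_le_sq' hy.1 hy.2
  have h1 : 2 * (1 - 9 * y ^ 2) ≠ 0 := by linarith [h.one_sub_pos]
  unfold bandParam
  fun_prop (disch := assumption)

theorem continuousOn_bandDensity (h : IsBand j c d ε a) :
    ContinuousOn (bandDensity ε a) (Ioo (-a) a) := by
  have : ContinuousOn (fun y => bandShape (bandParam ε y)) (Ioo (-a) a) := by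
    intro y hy
    obtain ⟨h1, h2⟩ := h.bandParam_pos hy
    have h3 := h.continuousAt_bandParam (Ioo_subset_Icc_self hy)
    have h4 : 3 * Real.pi * (bandParam ε y + 11) * √(bandParam ε y * (9 - bandParam ε y)) ≠ 0 := by
      have := Real.sqrt_pos.2 h2
      positivity
    refine ContinuousAt.continuousWithinAt ?_
    unfold bandShape
    fun_prop (disch := assumption)
  exact this.congr fun y hy => by rw [bandDensity, indicator_of_mem hy]

/-- At an edge s(9 - s) vanishes, with s = 9 for band 0 and s = 0 for band 2, while the remaining
factor of `bandShape` has a positive limit. -/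
theorem tendsto_bandDensity (h : IsBand j c d ε a) {b : ℝ} (hb : b ∈ Icc (-a) a)
    (hba : b ^ 2 = a ^ 2) : Tendsto (bandDensity ε a) (𝓝[Ioo (-a) a] b) atTop := by
  have hp : bandParam ε b = bandParam ε a := by rw [bandParam, bandParam, hba]
  have hc : Tendsto (bandParam ε) (𝓝[Ioo (-a) a] b) (𝓝 (bandParam ε a)) :=
    hp ▸ (h.continuousAt_bandParam hb).tendsto.mono_left nhdsWithin_le_nhds
  have hpos := h.edge_pos
  have h11 : 3 * Real.pi * (bandParam ε a + 11) ≠ 0 := by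
    intro h0
    rw [h0, div_zero] at hpos
    exact hpos.false
  have h1 : Tendsto (fun y => |3 * bandParam ε y - 7| ^ 3 / (3 * Real.pi * (bandParam ε y + 11)))
      (𝓝[Ioo (-a) a] b)
      (𝓝 (|3 * bandParam ε a - 7| ^ 3 / (3 * Real.pi * (bandParam ε a + 11)))) :=
    ((((hc.const_mul 3).sub_const 7).abs.pow 3).div ((hc.add_const 11).const_mul _) h11)
  have h2 : Tendsto (fun y => √(bandParam ε y * (9 - bandParam ε y))) (𝓝[Ioo (-a) a] b)
      (𝓝[>] 0) := by
    refine tendsto_nhdsWithin_iff.2 ⟨?_, ?_⟩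
    · have := (hc.mul (hc.const_sub 9)).sqrt
      rwa [h.edge, Real.sqrt_zero] at this
    · filter_upwards [self_mem_nhdsWithin] with y hy
      exact Real.sqrt_pos.2 (h.bandParam_pos hy).2
  refine (h1.pos_mul_atTop hpos h2.inv_tendsto_nhdsGT_zero).congr' ?_
  filter_upwards [self_mem_nhdsWithin] with y hy
  rw [bandDensity, indicator_of_mem hy, bandShape, Pi.inv_apply, ← div_eq_mul_inv, div_div]

theorem injOn_bandVelocity (h : IsBand j c d ε a) : InjOn (bandVelocity j) (Ioo c d) := by
  refine StrictMonoOn.injOn (strictMonoOn_of_deriv_pos (convex_Ioo _ _) ?_ ?_)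
  · exact fun k hk =>
      (hasDerivAt_bandVelocity h.lt_three (h.sq_lt_one k hk)).continuousAt.continuousWithinAt
  · intro k hk
    rw [interior_Ioo] at hk
    rw [(hasDerivAt_bandVelocity h.lt_three (h.sq_lt_one k hk)).deriv]
    exact h.acceleration_pos k hk

theorem hasDerivWithinAt (h : IsBand j c d ε a) :
    ∀ k ∈ Ioo c d, HasDerivWithinAt (bandVelocity j) (bandAcceleration j k) (Ioo c d) k :=
  fun k hk => (hasDerivAt_bandVelocity h.lt_three (h.sq_lt_one k hk)).hasDerivWithinAt

theorem smul_bandDensity (h : IsBand j c d ε a) (g : ℝ → ℂ) {k : ℝ} (hk : k ∈ Ioo c d) :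
    |bandAcceleration j k| • (bandDensity ε a (bandVelocity j k) • g (bandVelocity j k)) =
      (1 / (3 * Real.pi)) • g (bandVelocity j k) := by
  have := h.acceleration_pos k hk
  rw [h.bandDensity_bandVelocity hk, smul_smul, abs_of_pos this]
  congr 1
  field_simp

/-- Substitution y = x(k): the Jacobian |x'(k)| cancels the density 1/(3π|x'(k)|) and leaves a
constant weight in k. -/
theorem integral_bandDensity_smul (h : IsBand j c d ε a) (g : ℝ → ℂ) :
    ∫ y, bandDensity ε a y • g y = (1 / (3 * Real.pi)) • ∫ k in c..d, g (bandVelocity j k) := by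
  have h1 : ∫ y, bandDensity ε a y • g y = ∫ y in Ioo (-a) a, bandDensity ε a y • g y := by
    rw [setIntegral_eq_integral_of_forall_compl_eq_zero]
    intro y hy
    rw [bandDensity, indicator_of_notMem hy, zero_smul]
  rw [h1, ← h.image_eq, integral_image_eq_integral_abs_deriv_smul measurableSet_Ioo
    h.hasDerivWithinAt h.injOn_bandVelocity, setIntegral_congr_fun measurableSet_Ioo
    (fun k hk => h.smul_bandDensity g hk), integral_smul,
    intervalIntegral.integral_of_le h.le, integral_Ioc_eq_integral_Ioo]

theorem integrable_bandDensity (h : IsBand j c d ε a) : Integrable (bandDensity ε a) := by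
  rw [← integrableOn_iff_integrable_of_support_subset (h.support_bandDensity).subset,
    ← h.image_eq, integrableOn_image_iff_integrableOn_abs_deriv_smul measurableSet_Ioo
    h.hasDerivWithinAt h.injOn_bandVelocity]
  refine (integrableOn_const (C := 1 / (3 * Real.pi)) (by simp)).congr_fun ?_ measurableSet_Ioo
  intro k hk
  have := h.acceleration_pos k hk
  simp only [smul_eq_mul]
  rw [h.bandDensity_bandVelocity hk, abs_of_pos this]
  field_simp

theorem integral_bandDensity (h : IsBand j c d ε a) :
    ∫ y, bandDensity ε a y = (d - c) / (3 * Real.pi) := by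
  have := h.integral_bandDensity_smul fun _ => 1
  rw [intervalIntegral.integral_const] at this
  have h2 : ∫ y, bandDensity ε a y • (1 : ℂ) = ((∫ y, bandDensity ε a y : ℝ) : ℂ) := by
    rw [← integral_complex_ofReal]
    simp
  rw [h2] at this
  apply Complex.ofReal_injective
  rw [this]
  simp
  ring

end IsBand

theorem graph_groupVelocity {j : ℕ} {c d ε a : ℝ} (h : IsBand j c d ε a) :
    (fun y => (y, bandDensity ε a y)) '' Ioo (-a) a =
      (fun k => (groupVelocity j 0 k, 1 / (3 * Real.pi * |deriv (groupVelocity j 0) k|))) ''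
        Ioo c d := by
  rw [h.graph_bandDensity]
  refine image_congr fun k hk => ?_
  rw [groupVelocity_eq h.lt_three 0 (h.sq_lt_one k hk),
    (hasDerivAt_groupVelocity h.lt_three (h.sq_lt_one k hk)).deriv, pow_zero, one_mul]

theorem differentiableAt_groupVelocity {j : ℕ} {c d ε a : ℝ} (h : IsBand j c d ε a) :
    ∀ k ∈ Ioo c d, DifferentiableAt ℝ (walkEigenvalue j 0) k ∧
      DifferentiableAt ℝ (groupVelocity j 0) k ∧ deriv (groupVelocity j 0) k ≠ 0 := by
  intro k hk
  have h1 := hasDerivAt_groupVelocity h.lt_three (h.sq_lt_one k hk)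
  refine ⟨(hasDerivAt_walkEigenvalue h.lt_three 0 (h.sq_lt_one k hk)).differentiableAt,
    h1.differentiableAt, ?_⟩
  rw [h1.deriv]
  exact (h.acceleration_pos k hk).ne'

/-! ### Powers of a family of unitary matrices at nearby parameters -/

section UnitaryFamily

open Matrix

variable {n : Type*} [Fintype n] [DecidableEq n]

/-- The base is 1 - (ξ/t) · star (ν k₀) · ν' + o(1/t), so this is the limit (1 + z/t)^t → exp z. -/
theorem tendsto_mul_pow_exp {ν : ℝ → ℂ} {ν' : ℂ} {k₀ : ℝ} (hν : HasDerivAt ν ν' k₀)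
    (h1 : star (ν k₀) * ν k₀ = 1) (ξ : ℝ) :
    Tendsto (fun t : ℕ => (star (ν k₀) * ν (k₀ - ξ / t)) ^ t) atTop
      (𝓝 (Complex.exp (-(ξ * (star (ν k₀) * ν'))))) := by
  have hf : HasDerivAt (fun s : ℝ => star (ν k₀) * ν (k₀ - ξ * s)) (star (ν k₀) * (-ξ • ν')) 0 := by
    have h2 : HasDerivAt (fun s : ℝ => k₀ - ξ * s) (-ξ) 0 := by
      simpa using ((hasDerivAt_id (0 : ℝ)).const_mul ξ).const_sub k₀
    have h3 : HasDerivAt ν ν' (k₀ - ξ * 0) := by simpa using hν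
    exact (h3.scomp (0 : ℝ) h2).const_mul _
  have h4 := (hasDerivAt_iff_tendsto_slope_zero.1 hf).comp
    (f := fun t : ℕ => (t : ℝ)⁻¹) (tendsto_nhdsWithin_iff.2
      ⟨tendsto_inv_atTop_nhds_zero_nat (𝕜 := ℝ), (eventually_ge_atTop 1).mono fun t ht => by
        simp only [mem_compl_iff, mem_singleton_iff, inv_eq_zero, Nat.cast_eq_zero]; omega⟩)
  have h5 := Complex.tendsto_one_add_pow_exp_of_tendsto
    (g := fun t : ℕ => star (ν k₀) * ν (k₀ - ξ / t) - 1) (t := -(ξ * (star (ν k₀) * ν'))) (by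
      convert! h4 using 1
      · ext t
        simp only [Function.comp_apply, zero_add, mul_zero, sub_zero, inv_inv,
          div_eq_mul_inv, h1, Complex.real_smul, Complex.ofReal_natCast]
      · simp only [Complex.real_smul, Complex.ofReal_neg]
        ring_nf)
  simpa using h5

theorem star_dotProduct_eq_zero_of_eigen {M : Matrix n n ℂ} (hM : Mᴴ * M = 1) {v w : n → ℂ}
    {μ ν : ℂ} (hv : M *ᵥ v = μ • v) (hw : M *ᵥ w = ν • w) (hμ : star μ * μ = 1) (hne : μ ≠ ν) :
    star v ⬝ᵥ w = 0 := by
  have h1 : star (M *ᵥ v) ⬝ᵥ (M *ᵥ w) = star v ⬝ᵥ w := by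
    rw [star_mulVec, ← dotProduct_mulVec, mulVec_mulVec, hM, one_mulVec]
  rw [hv, hw, star_smul, smul_dotProduct, dotProduct_smul, smul_smul, smul_eq_mul] at h1
  by_contra h0
  have h2 : star μ * ν = 1 := by
    have := mul_right_cancel₀ h0 (h1.trans (one_mul _).symm)
    exact this
  have hμ0 : star μ ≠ 0 := left_ne_zero_of_mul_eq_one hμ
  exact hne (mul_left_cancel₀ hμ0 (hμ.trans h2.symm))

/-- The matrix whose columns are the normalized vectors `v a`. -/
noncomputable def normalizedColumns {n : Type*} [Fintype n] (v : n → n → ℂ) : Matrix n n ℂ :=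
  Matrix.of fun b a => ((√(∑ c, ‖v a c‖ ^ 2))⁻¹ : ℝ) • v a b

theorem sum_norm_sq_pos {m : Type*} [Fintype m] {w : m → ℂ} (h : w ≠ 0) : 0 < ∑ c, ‖w c‖ ^ 2 := by
  obtain ⟨c, hc⟩ := Function.ne_iff.1 h
  have : w c ≠ 0 := hc
  exact Finset.sum_pos' (fun _ _ => by positivity) ⟨c, Finset.mem_univ _, by positivity⟩

theorem continuousAt_normalizedColumns {n : Type*} [Fintype n] {v : n → ℝ → n → ℂ} {k₀ : ℝ}
    (hv : ∀ a, ContinuousAt (v a) k₀) (hv0 : ∀ a, v a k₀ ≠ 0) :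
    ContinuousAt (fun k => normalizedColumns fun a => v a k) k₀ := by
  refine continuousAt_pi.2 fun b => continuousAt_pi.2 fun a => ?_
  have hc : ∀ c, ContinuousAt (fun k => v a k c) k₀ := fun c => continuousAt_pi.1 (hv a) c
  have h0 : √(∑ c, ‖v a k₀ c‖ ^ 2) ≠ 0 := (Real.sqrt_pos.2 (sum_norm_sq_pos (hv0 a))).ne'
  have hs : ContinuousAt (fun k => ∑ c, ‖v a k c‖ ^ 2) k₀ :=
    tendsto_finsetSum _ fun c _ => ((hc c).norm.pow 2)
  exact (hs.sqrt.inv₀ h0).smul (hc b)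

theorem normalizedColumns_unitary {v : n → n → ℂ} (h0 : ∀ a, v a ≠ 0)
    (hort : ∀ a b, a ≠ b → star (v a) ⬝ᵥ v b = 0) :
    (normalizedColumns v)ᴴ * normalizedColumns v = 1 := by
  have hself : ∀ a, star (v a) ⬝ᵥ v a = ((∑ c, ‖v a c‖ ^ 2 : ℝ) : ℂ) := by
    intro a
    push_cast
    refine Finset.sum_congr rfl fun c _ => ?_
    simp only [Pi.star_apply]
    rw [← Complex.conj_mul']
    rfl
  ext a b
  have h1 : ((normalizedColumns v)ᴴ * normalizedColumns v) a b =
      ((√(∑ c, ‖v a c‖ ^ 2))⁻¹ : ℝ) * ((√(∑ c, ‖v b c‖ ^ 2))⁻¹ : ℝ) * (star (v a) ⬝ᵥ v b) := by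
    simp only [Matrix.mul_apply, conjTranspose_apply, normalizedColumns, of_apply, dotProduct,
      Finset.mul_sum, Pi.star_apply, Complex.real_smul]
    refine Finset.sum_congr rfl fun c _ => ?_
    simp
    ring
  rw [h1]
  by_cases hab : a = b
  · subst hab
    have hpos := sum_norm_sq_pos (h0 a)
    rw [hself, ← Complex.ofReal_mul, ← Complex.ofReal_mul, one_apply_eq, ← mul_inv,
      Real.mul_self_sqrt hpos.le, inv_mul_cancel₀ hpos.ne', Complex.ofReal_one]
  · rw [hort a b hab, mul_zero, one_apply_ne hab]

theorem mul_normalizedColumns {M : Matrix n n ℂ} {v : n → n → ℂ} {ν : n → ℂ}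
    (h : ∀ a, M *ᵥ v a = ν a • v a) :
    M * normalizedColumns v = normalizedColumns v * diagonal ν := by
  ext b a
  rw [mul_diagonal]
  have h1 := congrFun (h a) b
  simp only [mulVec, dotProduct, Pi.smul_apply, smul_eq_mul] at h1
  simp only [Matrix.mul_apply, normalizedColumns, of_apply, Complex.real_smul]
  rw [mul_assoc, mul_comm (v a b), ← h1, Finset.mul_sum]
  exact Finset.sum_congr rfl fun c _ => by ring

theorem pow_eq_of_mul_eq {M V D : Matrix n n ℂ} (hV : Vᴴ * V = 1) (h : M * V = V * D) (t : ℕ) :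
    M ^ t = V * D ^ t * Vᴴ := by
  have hV' : V * Vᴴ = 1 := mul_eq_one_comm.1 hV
  have : M ^ t * V = V * D ^ t := by
    induction t with
    | zero => simp
    | succ t ih => rw [pow_succ, mul_assoc, h, ← mul_assoc, ih, mul_assoc, ← pow_succ]
  rw [← this, mul_assoc, hV', mul_one]

/-- Both powers are expanded in their own eigenbases. The time dependence sits in the phases, and
the weights are the squared moduli of the overlaps between the two bases. -/
theorem trace_conj_pow_mul_pow {M₀ M V₀ V : Matrix n n ℂ} {ν₀ ν : n → ℂ} (hV₀ : V₀ᴴ * V₀ = 1)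
    (hV : Vᴴ * V = 1) (h₀ : M₀ * V₀ = V₀ * diagonal ν₀) (h : M * V = V * diagonal ν) (t : ℕ) :
    trace ((M₀ ^ t)ᴴ * M ^ t) = ∑ a, ∑ b, (star (ν₀ a) * ν b) ^ t *
      ((V₀ᴴ * V) a b * star ((V₀ᴴ * V) a b)) := by
  rw [pow_eq_of_mul_eq hV₀ h₀, pow_eq_of_mul_eq hV h, diagonal_pow, diagonal_pow]
  have h1 : (V₀ * diagonal (ν₀ ^ t) * V₀ᴴ)ᴴ * (V * diagonal (ν ^ t) * Vᴴ) =
      V₀ * (diagonal (star (ν₀ ^ t)) * (V₀ᴴ * V) * diagonal (ν ^ t) * Vᴴ) := by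
    simp only [conjTranspose_mul, conjTranspose_conjTranspose, diagonal_conjTranspose, mul_assoc]
  rw [h1, trace_mul_comm, mul_assoc _ _ V₀]
  have h2 : Vᴴ * V₀ = (V₀ᴴ * V)ᴴ := by simp
  rw [h2]
  set W := V₀ᴴ * V
  simp only [trace, diag_apply]
  refine Finset.sum_congr rfl fun a _ => ?_
  rw [Matrix.mul_apply]
  refine Finset.sum_congr rfl fun b _ => ?_
  rw [mul_diagonal, diagonal_mul, conjTranspose_apply]
  simp only [Pi.star_apply, Pi.pow_apply, star_pow]
  ring

/-- Distinct eigenvalues make the normalised eigenvectors orthonormal near k₀. Their continuity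
makes the overlap matrix tend to the identity, so off-diagonal terms vanish because their phases
have modulus one, and each diagonal term converges by `tendsto_mul_pow_exp`. -/
theorem tendsto_trace_conj_pow_mul_pow {M : ℝ → Matrix n n ℂ} {v : n → ℝ → n → ℂ}
    {ν : n → ℝ → ℂ} {ν' : n → ℂ} {k₀ : ℝ} (hM : ∀ k, (M k)ᴴ * M k = 1)
    (hv : ∀ a, ContinuousAt (v a) k₀) (hv0 : ∀ a, v a k₀ ≠ 0)
    (heig : ∀ a, ∀ᶠ k in 𝓝 k₀, M k *ᵥ v a k = ν a k • v a k)
    (hνd : ∀ a, HasDerivAt (ν a) (ν' a) k₀)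
    (hν1 : ∀ a, ∀ᶠ k in 𝓝 k₀, star (ν a k) * ν a k = 1)
    (hinj : Function.Injective fun a => ν a k₀) (ξ : ℝ) :
    Tendsto (fun t : ℕ => trace ((M k₀ ^ t)ᴴ * M (k₀ - ξ / t) ^ t)) atTop
      (𝓝 (∑ a, Complex.exp (-(ξ * (star (ν a k₀) * ν' a))))) := by
  have hkt : Tendsto (fun t : ℕ => k₀ - ξ / t) atTop (𝓝 k₀) := by
    simpa using (tendsto_const_div_atTop_nhds_zero_nat ξ).const_sub k₀
  have hne : ∀ a b, a ≠ b → ∀ᶠ k in 𝓝 k₀, ν a k ≠ ν b k := fun a b hab =>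
    ((hνd a).continuousAt.ne_iff_eventually_ne (hνd b).continuousAt).1 (hinj.ne hab)
  have hgood : ∀ᶠ k in 𝓝 k₀, (normalizedColumns fun a => v a k)ᴴ *
      (normalizedColumns fun a => v a k) = 1 ∧
      M k * (normalizedColumns fun a => v a k) =
        (normalizedColumns fun a => v a k) * diagonal fun a => ν a k := by
    have h1 : ∀ᶠ k in 𝓝 k₀, ∀ a, v a k ≠ 0 :=
      eventually_all.2 fun a => (hv a).eventually_ne (hv0 a)
    have h2 : ∀ᶠ k in 𝓝 k₀, ∀ a b, a ≠ b → ν a k ≠ ν b k :=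
      eventually_all.2 fun a => eventually_all.2 fun b => by
        by_cases hab : a = b
        · simp [hab]
        · filter_upwards [hne a b hab] with k hk _ using hk
    filter_upwards [h1, h2, eventually_all.2 heig, eventually_all.2 hν1] with k h1 h2 h3 h4
    exact ⟨normalizedColumns_unitary h1 fun a b hab =>
      star_dotProduct_eq_zero_of_eigen (hM k) (h3 a) (h3 b) (h4 a) (h2 a b hab),
      mul_normalizedColumns h3⟩
  obtain ⟨hV₀, hMV₀⟩ := hgood.self_of_nhds
  set V : ℝ → Matrix n n ℂ := fun k => normalizedColumns fun a => v a k with hVdef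
  have hVc : ContinuousAt V k₀ := continuousAt_normalizedColumns hv hv0
  have hW : Tendsto (fun t : ℕ => (V k₀)ᴴ * V (k₀ - ξ / t)) atTop (𝓝 1) := by
    rw [← hV₀]
    exact ((continuous_const.matrix_mul continuous_id).tendsto _).comp (hVc.tendsto.comp hkt)
  have hWab : ∀ a b, Tendsto (fun t : ℕ => ((V k₀)ᴴ * V (k₀ - ξ / t)) a b *
      star (((V k₀)ᴴ * V (k₀ - ξ / t)) a b)) atTop
      (𝓝 ((1 : Matrix n n ℂ) a b * star ((1 : Matrix n n ℂ) a b))) := fun a b => by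
    have h := ((continuous_id.matrix_elem a b).tendsto (1 : Matrix n n ℂ)).comp hW
    exact h.mul h.star
  have hlim : Tendsto (fun t : ℕ => ∑ a, ∑ b, (star (ν a k₀) * ν b (k₀ - ξ / t)) ^ t *
      (((V k₀)ᴴ * V (k₀ - ξ / t)) a b * star (((V k₀)ᴴ * V (k₀ - ξ / t)) a b))) atTop
      (𝓝 (∑ a, ∑ b, if a = b then Complex.exp (-(ξ * (star (ν a k₀) * ν' a))) else 0)) := by
    refine tendsto_finsetSum _ fun a _ => tendsto_finsetSum _ fun b _ => ?_
    split_ifs with hab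
    · subst hab
      have h := (tendsto_mul_pow_exp (hνd a) (hν1 a).self_of_nhds ξ).mul (hWab a a)
      simpa using h
    · have h := hWab a b
      rw [one_apply_ne hab, zero_mul] at h
      refine squeeze_zero_norm' ?_ (tendsto_zero_iff_norm_tendsto_zero.1 h)
      filter_upwards [hkt.eventually (hν1 b)] with t ht
      have hn : ∀ z : ℂ, star z * z = 1 → ‖z‖ = 1 := fun z hz => by
        have := congrArg norm hz
        rw [norm_mul, norm_star, norm_one] at this
        nlinarith [norm_nonneg z]
      rw [norm_mul, norm_pow, norm_mul, norm_star, hn _ ht, hn _ (hν1 a).self_of_nhds]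
      simp
  simp only [Finset.sum_ite_eq, Finset.mem_univ, if_true] at hlim
  refine hlim.congr' ?_
  filter_upwards [hkt.eventually hgood] with t ht
  exact (trace_conj_pow_mul_pow hV₀ ht.1 hMV₀ ht.2 t).symm

/-- The product is unitary, so its diagonal entries have modulus at most one. This supplies the
dominating constant for the passage to the limit under the integral. -/
theorem norm_trace_conj_pow_mul_pow_le {A B : Matrix n n ℂ} (hA : Aᴴ * A = 1)
    (hB : Bᴴ * B = 1) (t : ℕ) : ‖trace ((A ^ t)ᴴ * B ^ t)‖ ≤ Fintype.card n := by
  have hA' : A ∈ unitaryGroup n ℂ := mem_unitaryGroup_iff'.2 hA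
  have hB' : B ∈ unitaryGroup n ℂ := mem_unitaryGroup_iff'.2 hB
  have hAt : star (A ^ t) * B ^ t ∈ unitaryGroup n ℂ :=
    mul_mem (Unitary.star_mem (pow_mem hA' t)) (pow_mem hB' t)
  refine (norm_sum_le _ _).trans ?_
  refine (Finset.sum_le_sum fun a _ => entry_norm_bound_of_unitary hAt a a).trans ?_
  simp

end UnitaryFamily

/-! ### Arcs of the chain of 4-cycles -/

/-- The arcs of the chain up to translation. The first letter is the origin (`z`, `p`, `u`, `d`
for `0`, `0'`, `u`, `d`), the second the terminus, or `b` for the bridge. -/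
inductive ArcType
  | zu | zd | zb | pu | pd | pb | uz | up | dz | dp
  deriving DecidableEq

instance : Fintype ArcType where
  elems := {.zu, .zd, .zb, .pu, .pd, .pb, .uz, .up, .dz, .dp}
  complete := by intro a; cases a <;> decide

namespace ArcType

/-- The origin. -/
def src : ArcType → C4Vertex
  | zu | zd | zb => .zero
  | pu | pd | pb => .zeroPrime
  | uz | up => .u
  | dz | dp => .d

/-- The terminus. -/
def tgt : ArcType → C4Vertex
  | zu | pu => .u
  | zd | pd => .d
  | uz | dz | pb => .zero
  | up | dp | zb => .zeroPrime

/-- The change of cell along the arc. -/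
def shift : ArcType → ℤ
  | zb => 1
  | pb => -1
  | _ => 0

/-- The inverse arc. -/
def rev : ArcType → ArcType
  | zu => uz | zd => dz | zb => pb | pu => up | pd => dp
  | pb => zb | uz => zu | up => pu | dz => zd | dp => pd

theorem card_eq : Fintype.card ArcType = 10 := by decide

theorem src_rev (a : ArcType) : a.rev.src = a.tgt := by cases a <;> rfl

theorem tgt_rev (a : ArcType) : a.rev.tgt = a.src := by cases a <;> rfl

theorem shift_rev (a : ArcType) : a.rev.shift = -a.shift := by cases a <;> rfl

theorem eq_of_src_tgt {a b : ArcType} (h : a.src = b.src) (h' : a.tgt = b.tgt)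
    (hs : a.shift = b.shift) : a = b := by
  revert a b
  decide

end ArcType

theorem chainGraph_adj_arc (j : ℤ) (a : ArcType) :
    chainGraph.Adj (j, a.src) (j + a.shift, a.tgt) := by
  rw [chainGraph, SimpleGraph.fromRel_adj]
  cases a <;> simp [chainEdge, ArcType.src, ArcType.tgt, ArcType.shift]

/-- The arc of type `a` with origin in the cell `j`. -/
def chainArc (j : ℤ) (a : ArcType) : chainGraph.Dart :=
  ⟨((j, a.src), (j + a.shift, a.tgt)), chainGraph_adj_arc j a⟩

theorem exists_arcType_of_adj {p q : ℤ × C4Vertex} (h : chainGraph.Adj p q) :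
    ∃ a : ArcType, a.src = p.2 ∧ q = (p.1 + a.shift, a.tgt) := by
  obtain ⟨j, v⟩ := p
  obtain ⟨i, w⟩ := q
  rw [chainGraph, SimpleGraph.fromRel_adj] at h
  simp only [chainEdge] at h
  rcases h.2 with (⟨h1, h2⟩ | ⟨h1, h2, h3⟩) | (⟨h1, h2⟩ | ⟨h1, h2, h3⟩)
  · rcases h2 with ⟨rfl, rfl⟩ | ⟨rfl, rfl⟩ | ⟨rfl, rfl⟩ | ⟨rfl, rfl⟩
    · exact ⟨.zu, rfl, by simp [h1, ArcType.shift, ArcType.tgt]⟩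
    · exact ⟨.up, rfl, by simp [h1, ArcType.shift, ArcType.tgt]⟩
    · exact ⟨.pd, rfl, by simp [h1, ArcType.shift, ArcType.tgt]⟩
    · exact ⟨.dz, rfl, by simp [h1, ArcType.shift, ArcType.tgt]⟩
  · subst h2 h3
    exact ⟨.zb, rfl, by simp [h1, ArcType.shift, ArcType.tgt]⟩
  · rcases h2 with ⟨rfl, rfl⟩ | ⟨rfl, rfl⟩ | ⟨rfl, rfl⟩ | ⟨rfl, rfl⟩
    · exact ⟨.uz, rfl, by simp [h1, ArcType.shift, ArcType.tgt]⟩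
    · exact ⟨.pu, rfl, by simp [h1, ArcType.shift, ArcType.tgt]⟩
    · exact ⟨.dp, rfl, by simp [h1, ArcType.shift, ArcType.tgt]⟩
    · exact ⟨.zd, rfl, by simp [h1, ArcType.shift, ArcType.tgt]⟩
  · subst h2 h3
    exact ⟨.pb, rfl, by simp [h1, ArcType.shift, ArcType.tgt]⟩

theorem chainArc_injective : Function.Injective fun p : ℤ × ArcType => chainArc p.1 p.2 := by
  rintro ⟨j, a⟩ ⟨i, b⟩ h
  have h1 : ((j, a.src), (j + a.shift, a.tgt)) = ((i, b.src), (i + b.shift, b.tgt)) :=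
    congrArg SimpleGraph.Dart.toProd h
  simp only [Prod.mk.injEq] at h1
  obtain ⟨⟨h1, h2⟩, h3, h4⟩ := h1
  subst h1
  rw [ArcType.eq_of_src_tgt h2 h4 (by omega)]

theorem chainArc_surjective : Function.Surjective fun p : ℤ × ArcType => chainArc p.1 p.2 := by
  intro e
  obtain ⟨a, h1, h2⟩ := exists_arcType_of_adj e.adj
  refine ⟨(e.fst.1, a), ?_⟩
  apply SimpleGraph.Dart.ext
  exact Prod.ext (Prod.ext rfl h1) h2.symm

/-- The arcs of the chain are the translates of the ten arc types. -/
noncomputable def chainArcEquiv : ℤ × ArcType ≃ chainGraph.Dart :=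
  Equiv.ofBijective _ ⟨chainArc_injective, chainArc_surjective⟩

theorem chainArcEquiv_apply (j : ℤ) (a : ArcType) : chainArcEquiv (j, a) = chainArc j a := rfl

theorem chainArc_symm (j : ℤ) (a : ArcType) :
    (chainArc j a).symm = chainArc (j + a.shift) a.rev := by
  apply SimpleGraph.Dart.ext
  change ((j + a.shift, a.tgt), (j, a.src)) =
    ((j + a.shift, a.rev.src), (j + a.shift + a.rev.shift, a.rev.tgt))
  rw [a.src_rev, a.tgt_rev, a.shift_rev]
  simp

/-- The arcs out of a vertex. -/
noncomputable def outArcEquiv (j : ℤ) (c : C4Vertex) :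
    {b : ArcType // b.src = c} ≃ chainGraph.neighborSet (j, c) :=
  Equiv.ofBijective (fun b => ⟨(j + b.1.shift, b.1.tgt), by
      have := chainGraph_adj_arc j b.1
      rw [b.2] at this
      exact this⟩) (by
    constructor
    · rintro ⟨a, ha⟩ ⟨b, hb⟩ h
      replace h : (j + a.shift, a.tgt) = (j + b.shift, b.tgt) := congrArg Subtype.val h
      rw [Prod.mk.injEq] at h
      exact Subtype.ext (ArcType.eq_of_src_tgt (ha.trans hb.symm) h.2 (add_left_cancel h.1))
    · rintro ⟨q, hq⟩
      obtain ⟨a, h1, h2⟩ := exists_arcType_of_adj hq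
      exact ⟨⟨a, h1⟩, Subtype.ext h2.symm⟩)

theorem dartOfNeighborSet_outArcEquiv (j : ℤ) (c : C4Vertex) (b : {b : ArcType // b.src = c}) :
    chainGraph.dartOfNeighborSet (j, c) (outArcEquiv j c b) = chainArc j b.1 := by
  obtain ⟨b, rfl⟩ := b
  rfl

theorem sum_neighborSet {β : Type*} [AddCommMonoid β] (f : chainGraph.Dart → β) (j : ℤ)
    (c : C4Vertex) : ∑ w : chainGraph.neighborSet (j, c), f (chainGraph.dartOfNeighborSet (j, c) w) =
      ∑ b : ArcType, if b.src = c then f (chainArc j b) else 0 := by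
  rw [← (outArcEquiv j c).sum_comp, ← Finset.sum_filter,
    ← Finset.sum_subtype_eq_sum_filter, Finset.subtype_univ]
  exact Finset.sum_congr rfl fun b _ => by rw [dartOfNeighborSet_outArcEquiv]

/-- The degree of a vertex of the chain. -/
def chainDegree (c : C4Vertex) : ℕ := Fintype.card {b : ArcType // b.src = c}

theorem degree_chainGraph (j : ℤ) (c : C4Vertex) : chainGraph.degree (j, c) = chainDegree c := by
  rw [← SimpleGraph.card_neighborSet_eq_degree, chainDegree]
  exact (Fintype.card_congr (outArcEquiv j c)).symm

/-- The coefficients of the Grover walk between arc types. -/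
def arcCoeff (a b : ArcType) : ℚ :=
  (if b.src = a.tgt then 2 / (chainDegree a.tgt : ℚ) else 0) - if b = a.rev then 1 else 0

theorem groverAmp_chainArc (ψ : chainGraph.Dart → ℂ) (j : ℤ) (a : ArcType) :
    groverAmp chainGraph ψ (chainArc j a) =
      ∑ b, (arcCoeff a b : ℂ) * ψ (chainArc (j + a.shift) b) := by
  have h1 : chainArc j a = (chainGraph.dartOfNeighborSet (j + a.shift, a.tgt)
      (outArcEquiv (j + a.shift) a.tgt ⟨a.rev, a.src_rev⟩)).symm := by
    rw [dartOfNeighborSet_outArcEquiv, ← chainArc_symm, SimpleGraph.Dart.symm_symm]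
  rw [h1, groverAmp_symm, dartOfNeighborSet_outArcEquiv, sum_neighborSet, degree_chainGraph]
  simp only [arcCoeff, Rat.cast_sub, sub_mul, Finset.sum_sub_distrib]
  congr 1
  · rw [Finset.mul_sum]
    refine Finset.sum_congr rfl fun b _ => ?_
    split_ifs <;> simp
  · rw [Finset.sum_eq_single a.rev]
    · simp
    · intro b _ hb
      simp [hb]
    · simp

theorem sum_vertexProb (Ψ : ArcSpace chainGraph) (t : ℕ) (j : ℤ) :
    ∑ v : C4Vertex, vertexProb chainGraph Ψ t (j, v) =
      ∑ a : ArcType, ‖((groverWalk chainGraph)^[t] Ψ) (chainArc j a)‖ ^ 2 := by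
  simp only [vertexProb]
  rw [Finset.sum_congr rfl fun v _ => sum_neighborSet
    (fun e => ‖((groverWalk chainGraph)^[t] Ψ) e‖ ^ 2) j v, Finset.sum_comm]
  simp

theorem sum_cellArcs_zero {β : Type*} [AddCommMonoid β] (f : chainGraph.Dart → β) :
    ∑ e ∈ cellArcs 0, f e = ∑ a : ArcType, f (chainArc 0 a) := by
  have h : cellArcs 0 = Finset.univ.map ⟨fun a => chainArc 0 a, fun a b h =>
      (Prod.mk.inj (chainArc_injective (a₁ := (0, a)) (a₂ := (0, b)) h)).2⟩ := by
    ext e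
    rw [mem_cellArcs]
    simp only [Finset.mem_map, Finset.mem_univ, true_and]
    constructor
    · intro he
      obtain ⟨⟨j, a⟩, rfl⟩ := chainArc_surjective e
      obtain rfl : j = 0 := he
      exact ⟨a, rfl⟩
    · rintro ⟨a, rfl⟩
      rfl
  rw [h, Finset.sum_map]
  rfl

/-! ### The walk in Fourier space -/

open Matrix in
/-- The Fourier symbol of the Grover walk. -/
noncomputable def walkSymbol (k : ℝ) : Matrix ArcType ArcType ℂ :=
  Matrix.of fun a b => Complex.exp (Complex.I * (k * a.shift)) * arcCoeff a b

/-- The columns are orthonormal. Rational coefficients make this a finite check; the phases of the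
symbol depend only on the row, so they drop out in `walkSymbol_unitary`. -/
theorem sum_arcCoeff_mul (b c : ArcType) :
    ∑ a, arcCoeff a b * arcCoeff a c = if b = c then 1 else 0 := by
  revert b c
  decide +kernel

open Matrix in
theorem walkSymbol_unitary (k : ℝ) : (walkSymbol k)ᴴ * walkSymbol k = 1 := by
  ext b c
  rw [Matrix.mul_apply, one_apply]
  have h := congrArg (fun q : ℚ => (q : ℂ)) (sum_arcCoeff_mul b c)
  simp only [Rat.cast_sum, Rat.cast_mul, apply_ite (Rat.cast (K := ℂ)), Rat.cast_one, Rat.cast_zero] at h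
  refine Eq.trans ?_ h
  refine Finset.sum_congr rfl fun a _ => ?_
  rw [conjTranspose_apply, walkSymbol, of_apply, of_apply]
  have h1 : star (Complex.exp (Complex.I * (k * a.shift))) *
      Complex.exp (Complex.I * (k * a.shift)) = 1 := by
    rw [Complex.star_def, ← Complex.exp_conj, ← Complex.exp_add]
    simp
  rw [star_mul']
  have h2 : star (arcCoeff a b : ℂ) = arcCoeff a b := by simp
  rw [h2]
  linear_combination (arcCoeff a b : ℂ) * arcCoeff a c * h1

theorem continuous_walkSymbol : Continuous walkSymbol := by
  refine continuous_pi fun a => continuous_pi fun b => ?_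
  simp only [walkSymbol, Matrix.of_apply]
  fun_prop

/-! ### Fourier series with finitely many terms -/

theorem integral_exp_int_mul (m : ℤ) :
    ∫ k in (0 : ℝ)..2 * Real.pi, Complex.exp (Complex.I * (m * k)) =
      if m = 0 then 2 * (Real.pi : ℂ) else 0 := by
  split_ifs with hm
  · subst hm
    simp
  · have hc : Complex.I * (m : ℂ) ≠ 0 := mul_ne_zero Complex.I_ne_zero (by exact_mod_cast hm)
    have h := integral_exp_mul_complex (a := 0) (b := 2 * Real.pi) hc
    simp only [mul_assoc] at h
    rw [h]
    have h1 : Complex.exp (Complex.I * (m * ((2 * Real.pi : ℝ) : ℂ))) = 1 := by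
      rw [Complex.exp_eq_one_iff]
      exact ⟨m, by push_cast; ring⟩
    rw [h1]
    simp

/-- Parseval, with the shift by η multiplying the j-th coefficient by exp(ijη). A shift of the wave
number thus generates the characteristic function in the position. -/
theorem integral_fourier_conj_mul (s : Finset ℤ) (a : ℤ → ℂ) (η : ℝ) :
    ∫ k in (0 : ℝ)..2 * Real.pi, star (∑ j ∈ s, a j * Complex.exp (-(Complex.I * (j * k)))) *
      (∑ j ∈ s, a j * Complex.exp (-(Complex.I * (j * (k - η : ℝ))))) =
      2 * Real.pi * ∑ j ∈ s, ‖a j‖ ^ 2 * Complex.exp (Complex.I * (j * η)) := by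
  have h1 : ∀ k : ℝ, star (∑ j ∈ s, a j * Complex.exp (-(Complex.I * (j * k)))) *
      (∑ j ∈ s, a j * Complex.exp (-(Complex.I * (j * (k - η : ℝ))))) =
      ∑ i ∈ s, ∑ j ∈ s, (star (a i) * a j * Complex.exp (Complex.I * (j * η))) *
        Complex.exp (Complex.I * ((i - j : ℤ) * k)) := by
    intro k
    rw [star_sum, Finset.sum_mul_sum]
    refine Finset.sum_congr rfl fun i _ => Finset.sum_congr rfl fun j _ => ?_
    rw [star_mul', Complex.star_def, ← Complex.exp_conj]
    have h2 : Complex.exp (Complex.I * (j * η)) * Complex.exp (Complex.I * ((i - j : ℤ) * k)) =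
        Complex.exp ((starRingEnd ℂ) (-(Complex.I * (i * k)))) *
          Complex.exp (-(Complex.I * (j * (k - η : ℝ)))) := by
      rw [← Complex.exp_add, ← Complex.exp_add]
      congr 1
      simp
      ring
    linear_combination (-((starRingEnd ℂ) (a i) * a j)) * h2
  simp only [h1]
  have hint : ∀ (z : ℂ) (m : ℤ), IntervalIntegrable
      (fun k : ℝ => z * Complex.exp (Complex.I * (m * k))) volume 0 (2 * Real.pi) := fun z m =>
    Continuous.intervalIntegrable (by fun_prop) _ _
  rw [intervalIntegral.integral_finsetSum fun i _ =>
    Continuous.intervalIntegrable (by fun_prop) _ _, Finset.mul_sum]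
  refine Finset.sum_congr rfl fun i hi => ?_
  rw [intervalIntegral.integral_finsetSum fun j _ => hint _ _, Finset.sum_eq_single i]
  · rw [intervalIntegral.integral_const_mul, integral_exp_int_mul, if_pos (sub_self i),
      Complex.star_def, Complex.conj_mul']
    ring
  · intro j _ hj
    rw [intervalIntegral.integral_const_mul, integral_exp_int_mul,
      if_neg (sub_ne_zero.2 hj.symm), mul_zero]
  · exact fun h => absurd hi h

theorem integral_fourier (s : Finset ℤ) (a : ℤ → ℂ) (h0 : 0 ∈ s) :
    ∫ k in (0 : ℝ)..2 * Real.pi, ∑ j ∈ s, a j * Complex.exp (-(Complex.I * (j * k))) =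
      2 * Real.pi * a 0 := by
  have h1 : ∀ (j : ℤ) (k : ℝ), Complex.exp (-(Complex.I * (j * k))) =
      Complex.exp (Complex.I * ((-j : ℤ) * k)) := fun j k => by
    congr 1; push_cast; ring
  simp only [h1]
  rw [intervalIntegral.integral_finsetSum fun j _ =>
    Continuous.intervalIntegrable (by fun_prop) _ _, Finset.sum_eq_single 0]
  · rw [intervalIntegral.integral_const_mul, integral_exp_int_mul, if_pos neg_zero, mul_comm]
  · intro j _ hj
    rw [intervalIntegral.integral_const_mul, integral_exp_int_mul, if_neg (neg_ne_zero.2 hj),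
      mul_zero]
  · exact fun h => absurd h0 h

/-! ### Amplitudes -/

/-- The amplitude of the arc of type `a` in the cell `j` at time `t`, for the walk started from
the arc of type `e` in the cell `0`. -/
noncomputable def walkAmp (t : ℕ) (e : ArcType) (j : ℤ) (a : ArcType) : ℂ :=
  ((groverWalk chainGraph)^[t] (arcState chainGraph (chainArc 0 e))) (chainArc j a)

theorem walkAmp_zero (e : ArcType) (j : ℤ) (a : ArcType) :
    walkAmp 0 e j a = if j = 0 ∧ a = e then 1 else 0 := by
  have h : chainArc j a = chainArc 0 e ↔ j = 0 ∧ a = e := by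
    rw [← chainArcEquiv_apply, ← chainArcEquiv_apply, chainArcEquiv.apply_eq_iff_eq, Prod.mk.injEq]
  rw [walkAmp, Function.iterate_zero_apply, arcState, lp.single_apply]
  by_cases h1 : j = 0 ∧ a = e
  · rw [if_pos h1, h.2 h1, Pi.single_eq_same]
  · rw [if_neg h1, Pi.single_eq_of_ne fun h2 => h1 (h.1 h2)]

theorem walkAmp_succ (t : ℕ) (e : ArcType) (j : ℤ) (a : ArcType) :
    walkAmp (t + 1) e j a = ∑ b, (arcCoeff a b : ℂ) * walkAmp t e (j + a.shift) b := by
  rw [walkAmp, Function.iterate_succ_apply']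
  exact groverAmp_chainArc _ j a

/-- An arc changes the cell by at most one, so the walk has finite speed and all sums over cells are
finite. -/
theorem walkAmp_eq_zero {t : ℕ} {j : ℤ} (h : j ∉ Finset.Icc (-(t : ℤ)) t) (e a : ArcType) :
    walkAmp t e j a = 0 := by
  induction t generalizing j a with
  | zero =>
    rw [walkAmp_zero, if_neg]
    rintro ⟨rfl, -⟩
    simp at h
  | succ t ih =>
    rw [walkAmp_succ]
    refine Finset.sum_eq_zero fun b _ => ?_
    rw [ih, mul_zero]
    have hs : -1 ≤ a.shift ∧ a.shift ≤ 1 := by cases a <;> decide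
    rw [Finset.mem_Icc] at h ⊢
    push_cast at h
    omega

/-- Induction on time. Summing over all of ℤ lets the translation by the shift of the arc be a mere
reindexing, with no window of cells to adjust. -/
theorem hasSum_walkAmp (t : ℕ) (e a : ArcType) (k : ℝ) :
    HasSum (fun j : ℤ => walkAmp t e j a * Complex.exp (-(Complex.I * (j * k))))
      ((walkSymbol k ^ t) a e) := by
  induction t generalizing a with
  | zero =>
    have h := hasSum_single (0 : ℤ) (f := fun j : ℤ => walkAmp 0 e j a *
      Complex.exp (-(Complex.I * (j * k)))) fun j hj => by simp [walkAmp_zero, hj]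
    simpa [walkAmp_zero, Matrix.one_apply] using h
  | succ t ih =>
    rw [pow_succ', Matrix.mul_apply]
    have h1 : ∀ j : ℤ, walkAmp (t + 1) e j a * Complex.exp (-(Complex.I * (j * k))) =
        ∑ b, walkSymbol k a b * (walkAmp t e (j + a.shift) b *
          Complex.exp (-(Complex.I * ((j + a.shift : ℤ) * k)))) := by
      intro j
      rw [walkAmp_succ, Finset.sum_mul]
      refine Finset.sum_congr rfl fun b _ => ?_
      have h2 : Complex.exp (-(Complex.I * (j * k))) = Complex.exp (Complex.I * (k * a.shift)) *
          Complex.exp (-(Complex.I * ((j + a.shift : ℤ) * k))) := by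
        rw [← Complex.exp_add]
        congr 1
        push_cast
        ring
      rw [h2, walkSymbol, Matrix.of_apply]
      ring
    simp only [h1]
    exact hasSum_sum fun b _ => ((Equiv.addRight a.shift).hasSum_iff.2 (ih b)).mul_left _

theorem walkSymbol_pow_apply (t : ℕ) (e a : ArcType) (k : ℝ) :
    (walkSymbol k ^ t) a e = ∑ j ∈ Finset.Icc (-(t : ℤ)) t,
      walkAmp t e j a * Complex.exp (-(Complex.I * (j * k))) :=
  (hasSum_walkAmp t e a k).unique (hasSum_sum_of_ne_finset_zero fun j hj => by
    rw [walkAmp_eq_zero hj, zero_mul])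

/-- The averaged probability of finding the walk in the cell `j` at time `t`. -/
noncomputable def cellProb (t : ℕ) (j : ℤ) : ℝ :=
  1 / 10 * ∑ e : ArcType, ∑ a : ArcType, ‖walkAmp t e j a‖ ^ 2

theorem cellProb_nonneg (t : ℕ) (j : ℤ) : 0 ≤ cellProb t j := by
  unfold cellProb
  positivity

theorem cellProb_eq_zero {t : ℕ} {j : ℤ} (h : j ∉ Finset.Icc (-(t : ℤ)) t) : cellProb t j = 0 := by
  simp [cellProb, walkAmp_eq_zero h]

open Matrix in
-- Averaging over the ten initial arcs sums over the column index and so produces a trace; the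
-- constant is 1/10 times the 1/(2π) of Parseval.
theorem sum_cellProb_mul_exp (t : ℕ) (η : ℝ) :
    ∑ j ∈ Finset.Icc (-(t : ℤ)) t, cellProb t j * Complex.exp (Complex.I * (j * η)) =
      1 / (20 * Real.pi) * ∫ k in (0 : ℝ)..2 * Real.pi,
        trace ((walkSymbol k ^ t)ᴴ * walkSymbol (k - η) ^ t) := by
  have h1 : ∀ k : ℝ, trace ((walkSymbol k ^ t)ᴴ * walkSymbol (k - η) ^ t) =
      ∑ e, ∑ a, star ((walkSymbol k ^ t) a e) * (walkSymbol (k - η) ^ t) a e := by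
    intro k
    simp only [trace, diag_apply, Matrix.mul_apply, conjTranspose_apply]
  have hc : ∀ a e, Continuous fun k => (walkSymbol k ^ t) a e := fun a e =>
    (continuous_walkSymbol.pow t).matrix_elem a e
  have hcc : ∀ e a, Continuous fun k : ℝ => star ((walkSymbol k ^ t) a e) *
      (walkSymbol (k - η) ^ t) a e := fun e a =>
    (hc a e).star.mul ((hc a e).comp (continuous_id.sub continuous_const))
  simp only [h1]
  rw [intervalIntegral.integral_finsetSum fun e _ => Continuous.intervalIntegrable
    (continuous_finsetSum _ fun a _ => hcc e a) _ _]
  have h2 : ∀ e a, ∫ k in (0 : ℝ)..2 * Real.pi, star ((walkSymbol k ^ t) a e) *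
      (walkSymbol (k - η) ^ t) a e = 2 * Real.pi * ∑ j ∈ Finset.Icc (-(t : ℤ)) t,
        ‖walkAmp t e j a‖ ^ 2 * Complex.exp (Complex.I * (j * η)) := by
    intro e a
    rw [← integral_fourier_conj_mul]
    simp only [walkSymbol_pow_apply]
  rw [Finset.sum_congr rfl fun e _ => intervalIntegral.integral_finsetSum fun a _ =>
    (hcc e a).intervalIntegrable _ _]
  simp only [h2, ← Finset.mul_sum]
  simp only [cellProb]
  push_cast
  simp only [Finset.mul_sum, Finset.sum_mul]
  rw [Finset.sum_comm]
  refine Finset.sum_congr rfl fun e _ => ?_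
  rw [Finset.sum_comm]
  refine Finset.sum_congr rfl fun a _ => Finset.sum_congr rfl fun j _ => ?_
  have : (Real.pi : ℂ) ≠ 0 := by exact_mod_cast Real.pi_ne_zero
  field_simp
  ring

theorem walkAmp_zero_cell (t : ℕ) (e a : ArcType) :
    2 * Real.pi * walkAmp t e 0 a =
      ∫ k in (0 : ℝ)..2 * Real.pi, (walkSymbol k ^ t) a e := by
  simp only [walkSymbol_pow_apply]
  exact (integral_fourier _ (fun j => walkAmp t e j a) (by simp)).symm

/-! ### The law of the position -/

theorem averagedLaw_eq (t : ℕ) :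
    averagedLaw t = Measure.sum fun j : ℤ => ENNReal.ofReal (cellProb t j) • Measure.dirac j := by
  ext s hs
  simp only [averagedLaw, positionLaw, sum_vertexProb]
  rw [sum_cellArcs_zero]
  simp only [Measure.smul_apply, Measure.finsetSum_apply, Measure.sum_apply _ hs, smul_eq_mul]
  rw [← Summable.tsum_finsetSum fun _ _ => ENNReal.summable, ← ENNReal.tsum_mul_left]
  refine tsum_congr fun j => ?_
  rw [← Finset.sum_mul, ← mul_assoc, ← ENNReal.ofReal_sum_of_nonneg fun e _ => by positivity]
  congr 1
  rw [cellProb, ENNReal.ofReal_mul (by norm_num)]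
  congr 1
  rw [ENNReal.ofReal_div_of_pos (by norm_num)]
  simp

theorem sum_cellProb (t : ℕ) : ∑ j ∈ Finset.Icc (-(t : ℤ)) t, cellProb t j = 1 := by
  have h := sum_cellProb_mul_exp t 0
  have h1 : ∀ k : ℝ, (walkSymbol k ^ t).conjTranspose * walkSymbol (k - 0) ^ t = 1 := by
    intro k
    have hu : walkSymbol k ∈ Matrix.unitaryGroup ArcType ℂ :=
      Matrix.mem_unitaryGroup_iff'.2 (walkSymbol_unitary k)
    rw [sub_zero]
    exact Matrix.mem_unitaryGroup_iff'.1 (pow_mem hu t)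
  simp only [h1, Matrix.trace_one, ArcType.card_eq] at h
  apply Complex.ofReal_injective
  have hpi : (Real.pi : ℂ) ≠ 0 := by exact_mod_cast Real.pi_ne_zero
  push_cast
  simp at h
  rw [h]
  field_simp
  norm_num

instance isProbabilityMeasure_averagedLaw (t : ℕ) : IsProbabilityMeasure (averagedLaw t) := by
  refine ⟨?_⟩
  rw [averagedLaw_eq, Measure.sum_apply _ MeasurableSet.univ,
    tsum_eq_sum (s := Finset.Icc (-(t : ℤ)) t) fun j hj => by simp [cellProb_eq_zero hj]]
  simp only [Measure.smul_apply, measure_univ, smul_eq_mul, mul_one]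
  rw [← ENNReal.ofReal_sum_of_nonneg fun j _ => cellProb_nonneg t j, sum_cellProb,
    ENNReal.ofReal_one]

theorem averagedLaw_singleton (t : ℕ) (j : ℤ) :
    averagedLaw t {j} = ENNReal.ofReal (cellProb t j) := by
  rw [averagedLaw_eq, Measure.sum_apply _ (measurableSet_singleton _), tsum_eq_single j]
  · simp
  · intro i hi
    simp [hi]

theorem integral_averagedLaw (t : ℕ) (f : ℤ → ℂ) :
    ∫ j, f j ∂averagedLaw t = ∑ j ∈ Finset.Icc (-(t : ℤ)) t, cellProb t j * f j := by
  have h1 : averagedLaw t = ∑ j ∈ Finset.Icc (-(t : ℤ)) t,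
      ENNReal.ofReal (cellProb t j) • Measure.dirac j := by
    ext s hs
    rw [averagedLaw_eq, Measure.sum_apply _ hs, Measure.finsetSum_apply]
    exact tsum_eq_sum fun j hj => by simp [cellProb_eq_zero hj]
  rw [h1, integral_finsetSum_measure fun j _ => ?_]
  · refine Finset.sum_congr rfl fun j _ => ?_
    rw [integral_smul_measure, integral_dirac, ENNReal.toReal_ofReal (cellProb_nonneg t j),
      Complex.real_smul]
  · exact (integrable_dirac (by simp)).smul_measure (by simp)

/-- The law of `X_t / t`. -/
noncomputable def rescaledLaw (t : ℕ) : Measure ℝ :=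
  (averagedLaw t).map fun j : ℤ => (j : ℝ) / t

instance isProbabilityMeasure_rescaledLaw (t : ℕ) : IsProbabilityMeasure (rescaledLaw t) :=
  Measure.isProbabilityMeasure_map (measurable_of_countable _).aemeasurable

open Matrix in
theorem charFun_rescaledLaw (t : ℕ) (ξ : ℝ) :
    charFun (rescaledLaw t) ξ = 1 / (20 * Real.pi) * ∫ k in (0 : ℝ)..2 * Real.pi,
      trace ((walkSymbol k ^ t)ᴴ * walkSymbol (k - ξ / t) ^ t) := by
  rw [← sum_cellProb_mul_exp, charFun_apply_real, rescaledLaw,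
    integral_map (measurable_of_countable _).aemeasurable (by fun_prop), integral_averagedLaw]
  refine Finset.sum_congr rfl fun j _ => ?_
  congr 2
  push_cast
  ring

/-! ### Eigenvectors of the symbol -/

section Eigenvectors

open Matrix

theorem sum_arcType {β : Type*} [AddCommMonoid β] (f : ArcType → β) :
    ∑ a, f a = f .zu + (f .zd + (f .zb + (f .pu + (f .pd + (f .pb + (f .uz + (f .up +
      (f .dz + f .dp)))))))) := by
  have h : (Finset.univ : Finset ArcType) = {.zu, .zd, .zb, .pu, .pd, .pb, .uz, .up, .dz, .dp} :=
    rfl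
  rw [h]
  repeat rw [Finset.sum_insert (by decide)]
  rw [Finset.sum_singleton]

theorem chainDegree_ne_zero (c : C4Vertex) : (chainDegree c : ℂ) ≠ 0 := by
  have : chainDegree c ≠ 0 := by revert c; decide
  exact_mod_cast this

theorem sum_src_eq (c : C4Vertex) (z : ℂ) :
    ∑ b : ArcType, (if b.src = c then z else 0) = chainDegree c * z := by
  rw [← Finset.sum_filter, Finset.sum_const, nsmul_eq_mul, chainDegree, Fintype.card_subtype]

theorem walkSymbol_mulVec (k : ℝ) (φ : ArcType → ℂ) (a : ArcType) :
    (walkSymbol k *ᵥ φ) a = Complex.exp (Complex.I * (k * a.shift)) *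
      (2 / chainDegree a.tgt * (∑ b : ArcType, if b.src = a.tgt then φ b else 0) - φ a.rev) := by
  simp only [mulVec, dotProduct, walkSymbol, of_apply, mul_assoc, ← Finset.mul_sum, arcCoeff]
  congr 1
  simp only [Rat.cast_sub, sub_mul, Finset.sum_sub_distrib]
  congr 1
  · rw [Finset.mul_sum]
    refine Finset.sum_congr rfl fun b _ => ?_
    split_ifs <;> simp
  · rw [Finset.sum_eq_single a.rev]
    · simp
    · intro b _ hb
      simp [hb]
    · simp

/-- The eigenvector of the walk coming from a function `g` on the vertices. -/
noncomputable def bandVector (k : ℝ) (μ : ℂ) (g : C4Vertex → ℂ) (a : ArcType) : ℂ :=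
  Complex.exp (Complex.I * (k * a.shift)) * g a.tgt - μ * g a.src

/-- Spectral mapping for the Grover walk. At each terminus the twisted sum of g over neighbours is
replaced by degree times x g; the eigenvalue equation then reduces to μν = 1 and ν + μ = 2x. -/
theorem walkSymbol_mulVec_bandVector {k : ℝ} {x μ ν : ℂ} {g : C4Vertex → ℂ}
    (hg : ∀ c, ∑ b : ArcType, (if b.src = c then Complex.exp (Complex.I * (k * b.shift)) * g b.tgt
      else 0) = chainDegree c * (x * g c)) (h1 : μ * ν = 1) (h2 : ν + μ = 2 * x) :
    walkSymbol k *ᵥ bandVector k μ g = ν • bandVector k μ g := by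
  ext a
  rw [walkSymbol_mulVec, Pi.smul_apply, smul_eq_mul]
  have h3 : ∑ b : ArcType, (if b.src = a.tgt then bandVector k μ g b else 0) =
      chainDegree a.tgt * (x * g a.tgt) - chainDegree a.tgt * (μ * g a.tgt) := by
    rw [← hg, ← sum_src_eq, ← Finset.sum_sub_distrib]
    refine Finset.sum_congr rfl fun b _ => ?_
    split_ifs with hb
    · rw [bandVector, hb]
    · simp
  have h4 : bandVector k μ g a.rev =
      Complex.exp (-(Complex.I * (k * a.shift))) * g a.src - μ * g a.tgt := by
    rw [bandVector, a.tgt_rev, a.src_rev, a.shift_rev]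
    congr 3
    push_cast
    ring
  have h5 : Complex.exp (Complex.I * (k * a.shift)) * Complex.exp (-(Complex.I * (k * a.shift))) = 1 := by
    rw [← Complex.exp_add, add_neg_cancel, Complex.exp_zero]
  rw [h3, h4, bandVector]
  have hd := chainDegree_ne_zero a.tgt
  rw [← mul_sub, ← mul_assoc (2 / _), div_mul_cancel₀ _ hd]
  linear_combination (-g a.src) * h5 + g a.src * h1 -
    (Complex.exp (Complex.I * (k * a.shift)) * g a.tgt) * h2

/-- The eigenvector of the transition operator for the eigenvalue `x`. -/
noncomputable def bandPotential (k : ℝ) (x : ℂ) : C4Vertex → ℂ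
  | .zero => 3 * x + Complex.exp (Complex.I * k)
  | .zeroPrime => 3 * x + Complex.exp (-(Complex.I * k))
  | .u => (9 * x ^ 2 - 1) / 2
  | .d => (9 * x ^ 2 - 1) / 2

/-- At 0 and 0' the equation holds identically in x; at u and d it is exactly the cubic. -/
theorem bandPotential_eigen {k : ℝ} {x : ℂ} (hx : 9 * x ^ 3 - 7 * x = 2 * Complex.cos k)
    (c : C4Vertex) :
    ∑ b : ArcType, (if b.src = c then
      Complex.exp (Complex.I * (k * b.shift)) * bandPotential k x b.tgt else 0) =
      chainDegree c * (x * bandPotential k x c) := by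
  have h1 : Complex.exp (Complex.I * k) * Complex.exp (-(Complex.I * k)) = 1 := by
    rw [← Complex.exp_add, add_neg_cancel, Complex.exp_zero]
  have h2 : 2 * Complex.cos k = Complex.exp (Complex.I * k) + Complex.exp (-(Complex.I * k)) := by
    rw [Complex.two_cos, mul_comm, neg_mul, mul_comm]
  have hz : chainDegree .zero = 3 := by decide
  have hp : chainDegree .zeroPrime = 3 := by decide
  have hu : chainDegree .u = 2 := by decide
  have hd : chainDegree .d = 2 := by decide
  rw [sum_arcType]
  cases c <;> simp [ArcType.src, ArcType.tgt, ArcType.shift, bandPotential, hz, hp, hu, hd]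
  · linear_combination h1
  · linear_combination -h2 - hx
  · linear_combination h1
  · linear_combination -h2 - hx

/-- The function on the vertices that is antisymmetric under the exchange of `u` and `d`. -/
def dipole : C4Vertex → ℂ
  | .zero => 0
  | .zeroPrime => 0
  | .u => 1
  | .d => -1

theorem dipole_eigen (k : ℝ) (c : C4Vertex) :
    ∑ b : ArcType, (if b.src = c then Complex.exp (Complex.I * (k * b.shift)) * dipole b.tgt
      else 0) = chainDegree c * (0 * dipole c) := by
  rw [sum_arcType]
  cases c <;> simp [ArcType.src, ArcType.tgt, ArcType.shift, dipole]

/-- The alternating flow along the 4-cycle. -/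
def cycleFlow (ε : ℂ) : ArcType → ℂ
  | .zu => 1
  | .up => ε
  | .pd => 1
  | .dz => ε
  | .uz => -ε
  | .pu => -1
  | .dp => -ε
  | .zd => -1
  | .zb => 0
  | .pb => 0

/-- The values on the arcs leaving any vertex sum to zero, so the walk only sends f(a) to -f(ā). The
flow avoids the bridges, so no phase depending on k enters. -/
theorem walkSymbol_mulVec_cycleFlow {ε : ℂ} (hε : ε * ε = 1) (k : ℝ) :
    walkSymbol k *ᵥ cycleFlow ε = ε • cycleFlow ε := by
  ext a
  rw [walkSymbol_mulVec, sum_arcType]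
  cases a <;> simp [ArcType.src, ArcType.tgt, ArcType.shift, ArcType.rev, cycleFlow, hε]

/-- Labels of the eigenvalues of the walk: the six bands, the eigenvalues `±i`, and `±1`. -/
abbrev BandIndex : Type := (Fin 3 × Fin 2) ⊕ (Fin 2 ⊕ Fin 2)

/-- The eigenvalues of the symbol. -/
noncomputable def symbolEigenvalue : BandIndex → ℝ → ℂ
  | .inl (j, l), k => walkEigenvalue j l k
  | .inr (.inl l), _ => (-1) ^ (l : ℕ) * Complex.I
  | .inr (.inr l), _ => (-1) ^ (l : ℕ)

/-- The eigenvectors of the symbol. -/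
noncomputable def symbolEigenvector : BandIndex → ℝ → ArcType → ℂ
  | .inl (j, l), k => bandVector k (star (walkEigenvalue j l k)) (bandPotential k (cubicRoot j k))
  | .inr (.inl l), k => bandVector k (star ((-1) ^ (l : ℕ) * Complex.I)) dipole
  | .inr (.inr l), _ => cycleFlow ((-1) ^ (l : ℕ))

theorem cubicRoot_sq_le_one (j : Fin 3) (k : ℝ) : cubicRoot j k ^ 2 ≤ 1 := by
  fin_cases j
  · have := cubicRoot_zero_mem k
    exact pow_le_one₀ (by simpa using this.1.trans' (by norm_num)) (by simpa using this.2)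
  · have := cubicRoot_zero_mem (k + Real.pi)
    change cubicRoot 1 k ^ 2 ≤ 1
    rw [cubicRoot_one, neg_sq]
    exact pow_le_one₀ (this.1.trans' (by norm_num)) this.2
  · exact (cubicRoot_two_sq_lt_one k).le

theorem star_symbolEigenvalue_mul (i : BandIndex) (k : ℝ) :
    star (symbolEigenvalue i k) * symbolEigenvalue i k = 1 := by
  rcases i with ⟨j, l⟩ | l | l
  · rw [mul_comm]
    exact walkEigenvalue_mul_conj (cubicRoot_sq_le_one j k)
  · fin_cases l <;> simp [symbolEigenvalue]
  · fin_cases l <;> simp [symbolEigenvalue]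

theorem walkEigenvalue_re (j l : ℕ) (k : ℝ) : (walkEigenvalue j l k).re = cubicRoot j k := by
  rcases neg_one_pow_eq_or ℂ l with h | h <;> simp [walkEigenvalue, h]

theorem walkEigenvalue_im (j l : ℕ) (k : ℝ) :
    (walkEigenvalue j l k).im = (-1) ^ l * √(1 - cubicRoot j k ^ 2) := by
  rcases Nat.even_or_odd l with h | h <;>
    simp [walkEigenvalue, h.neg_one_pow]

theorem walkSymbol_mulVec_symbolEigenvector (i : BandIndex) (k : ℝ) :
    walkSymbol k *ᵥ symbolEigenvector i k = symbolEigenvalue i k • symbolEigenvector i k := by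
  have h1 := star_symbolEigenvalue_mul i k
  rcases i with ⟨j, l⟩ | l | l
  · refine walkSymbol_mulVec_bandVector (bandPotential_eigen ?_) h1 ?_
    · exact_mod_cast congrArg (fun x : ℝ => (x : ℂ)) (cubicRoot_cubic j k)
    · rw [Complex.star_def, symbolEigenvalue, Complex.add_conj, walkEigenvalue_re]
      push_cast
      rfl
  · refine walkSymbol_mulVec_bandVector (x := 0) (dipole_eigen k) h1 ?_
    fin_cases l <;> simp [symbolEigenvalue]
  · exact walkSymbol_mulVec_cycleFlow (by fin_cases l <;> simp) k

/-- The derivative of the phase of an eigenvalue of the symbol. -/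
noncomputable def symbolVelocity : BandIndex → ℝ → ℝ
  | .inl (j, l), k => (-1) ^ (l : ℕ) * bandVelocity j k
  | .inr _, _ => 0

theorem cubicRoot_sq_lt_one {k : ℝ} (hs : Real.sin k ≠ 0) (j : Fin 3) : cubicRoot j k ^ 2 < 1 := by
  refine lt_of_le_of_ne (cubicRoot_sq_le_one j k) fun h => hs ?_
  have := four_mul_sin_sq j k
  rw [h, sub_self, zero_mul] at this
  simpa using this

theorem cubicRoot_ne_zero {k : ℝ} (hc : Real.cos k ≠ 0) (j : ℕ) : cubicRoot j k ≠ 0 := by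
  intro h
  have := cubicRoot_cubic j k
  rw [h] at this
  exact hc (by linarith)

theorem hasDerivAt_symbolEigenvalue {k : ℝ} (hs : Real.sin k ≠ 0) (i : BandIndex) :
    HasDerivAt (symbolEigenvalue i)
      (-(Complex.I * symbolVelocity i k * symbolEigenvalue i k)) k := by
  rcases i with ⟨j, l⟩ | l | l
  · convert! hasDerivAt_walkEigenvalue j.2 l (cubicRoot_sq_lt_one hs j) using 1
    simp [symbolVelocity, symbolEigenvalue, mul_assoc]
  · have h : HasDerivAt (symbolEigenvalue (.inr (.inl l))) 0 k := hasDerivAt_const k _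
    simpa [symbolVelocity] using h
  · have h : HasDerivAt (symbolEigenvalue (.inr (.inr l))) 0 k := hasDerivAt_const k _
    simpa [symbolVelocity] using h

theorem injective_cubicRoot (k : ℝ) : Function.Injective fun j : Fin 3 => cubicRoot j k := by
  have h0 := cubicRoot_zero_mem k
  have h1 := cubicRoot_zero_mem (k + Real.pi)
  have h1' := cubicRoot_one k
  have h2 := cubicRoot_two_mem k
  intro i j h
  fin_cases i <;> fin_cases j <;> simp at h ⊢ <;> linarith

/-- The real parts λ_j separate the three bands and sin k ≠ 0 keeps each conjugate pair apart and
away from ±1; cos k ≠ 0 gives λ_j ≠ 0, hence keeps the bands away from ±i. -/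
theorem injective_symbolEigenvalue {k : ℝ} (hs : Real.sin k ≠ 0) (hc : Real.cos k ≠ 0) :
    Function.Injective fun i => symbolEigenvalue i k := by
  have hq : ∀ j : Fin 3, √(1 - cubicRoot j k ^ 2) ≠ 0 := fun j =>
    (Real.sqrt_pos.2 (by linarith [cubicRoot_sq_lt_one hs j])).ne'
  have hre : ∀ (j : Fin 3) (l : Fin 2), (symbolEigenvalue (.inl (j, l)) k).re = cubicRoot j k :=
    fun j l => walkEigenvalue_re j l k
  have him : ∀ (j : Fin 3) (l : Fin 2), (symbolEigenvalue (.inl (j, l)) k).im =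
      (-1) ^ (l : ℕ) * √(1 - cubicRoot j k ^ 2) := fun j l => walkEigenvalue_im j l k
  have hA : ∀ (j : Fin 3) (l m : Fin 2),
      symbolEigenvalue (.inl (j, l)) k ≠ symbolEigenvalue (.inr (.inl m)) k := fun j l m h => by
    have := congrArg Complex.re h
    rw [hre] at this
    refine cubicRoot_ne_zero hc j (this.trans ?_)
    fin_cases m <;> simp [symbolEigenvalue]
  have hB : ∀ (j : Fin 3) (l m : Fin 2),
      symbolEigenvalue (.inl (j, l)) k ≠ symbolEigenvalue (.inr (.inr m)) k := fun j l m h => by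
    have := congrArg Complex.im h
    rw [him] at this
    refine mul_ne_zero (pow_ne_zero _ (by norm_num)) (hq j) (this.trans ?_)
    fin_cases m <;> simp [symbolEigenvalue]
  have hC : ∀ l m : Fin 2,
      symbolEigenvalue (.inr (.inl l)) k ≠ symbolEigenvalue (.inr (.inr m)) k := fun l m h => by
    have := congrArg Complex.re h
    fin_cases l <;> fin_cases m <;> simp [symbolEigenvalue] at this
  rintro (⟨j, l⟩ | l | l) (⟨j', l'⟩ | l' | l') h
  · have h1 := congrArg Complex.re h
    have h2 := congrArg Complex.im h
    simp only [hre, him] at h1 h2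
    obtain rfl := injective_cubicRoot k h1
    have h3 := mul_right_cancel₀ (hq j) h2
    have : l = l' := by fin_cases l <;> fin_cases l' <;> first | rfl | (norm_num at h3)
    rw [this]
  · exact absurd h (hA _ _ _)
  · exact absurd h (hB _ _ _)
  · exact absurd h.symm (hA _ _ _)
  · have h1 := congrArg Complex.im h
    have : l = l' := by
      fin_cases l <;> fin_cases l' <;> first | rfl | (norm_num [symbolEigenvalue] at h1)
    rw [this]
  · exact absurd h (hC _ _)
  · exact absurd h.symm (hB _ _ _)
  · exact absurd h.symm (hC _ _)
  · have h1 := congrArg Complex.re h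
    have : l = l' := by
      fin_cases l <;> fin_cases l' <;> first | rfl | (norm_num [symbolEigenvalue] at h1)
    rw [this]

theorem symbolEigenvector_ne_zero {k : ℝ} (hs : Real.sin k ≠ 0) (i : BandIndex) :
    symbolEigenvector i k ≠ 0 := by
  intro h
  rcases i with ⟨j, l⟩ | l | l
  · have h1 := congrFun h .zu
    have h2 := congrFun h .uz
    have hν := star_symbolEigenvalue_mul (.inl (j, l)) k
    have him := walkEigenvalue_im j l k
    simp only [symbolEigenvector, symbolEigenvalue, bandVector, ArcType.shift, ArcType.tgt,
      ArcType.src, Int.cast_zero, mul_zero, Complex.exp_zero, one_mul, Pi.zero_apply] at h1 h2 hν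
    set ν := walkEigenvalue j l k
    set g := bandPotential k (cubicRoot j k)
    have hq : √(1 - cubicRoot j k ^ 2) ≠ 0 :=
      (Real.sqrt_pos.2 (by linarith [cubicRoot_sq_lt_one hs j])).ne'
    have him0 : ν.im ≠ 0 := by
      rw [him]
      exact mul_ne_zero (pow_ne_zero _ (by norm_num)) hq
    -- If the components on an arc and on its inverse both vanish, then so does g at the origin,
    -- since ν is not real; but the imaginary part of g(0) is sin k.
    have h3 : (ν - star ν) * g .zero = 0 := by
      linear_combination ν * h2 + h1 + g .u * hν
    have h4 : ν - star ν ≠ 0 := by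
      intro h0
      have := congrArg Complex.im h0
      simp at this
      exact him0 (by linarith)
    have h5 := congrArg Complex.im ((mul_eq_zero.1 h3).resolve_left h4)
    simp [g, bandPotential, Complex.exp_im] at h5
    exact hs h5
  · have h1 := congrFun h .zu
    simp [symbolEigenvector, bandVector, ArcType.shift, ArcType.tgt, ArcType.src, dipole] at h1
  · have h1 := congrFun h .zu
    simp [symbolEigenvector, cycleFlow] at h1

theorem continuousAt_symbolEigenvector {k : ℝ} (hs : Real.sin k ≠ 0) (i : BandIndex) :
    ContinuousAt (symbolEigenvector i) k := by
  refine continuousAt_pi.2 fun a => ?_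
  rcases i with ⟨j, l⟩ | l | l
  · have h1 : ContinuousAt (walkEigenvalue j l) k :=
      (hasDerivAt_symbolEigenvalue hs (.inl (j, l))).continuousAt
    have h2 : ContinuousAt (cubicRoot j) k := (continuous_cubicRoot j.2).continuousAt
    have h3 : ∀ c, ContinuousAt (fun k : ℝ => bandPotential k (cubicRoot j k) c) k := by
      intro c
      cases c <;> simp only [bandPotential] <;> fun_prop
    simp only [symbolEigenvector, bandVector]
    exact (ContinuousAt.mul (by fun_prop) (h3 _)).sub (h1.star.mul (h3 _))
  · simp only [symbolEigenvector, bandVector]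
    fun_prop
  · exact continuousAt_const

theorem card_bandIndex : Fintype.card ArcType = Fintype.card BandIndex := by
  rw [ArcType.card_eq]
  rfl

theorem tendsto_trace_walkSymbol {k : ℝ} (hs : Real.sin k ≠ 0) (hc : Real.cos k ≠ 0) (ξ : ℝ) :
    Tendsto (fun t : ℕ => trace ((walkSymbol k ^ t)ᴴ * walkSymbol (k - ξ / t) ^ t)) atTop
      (𝓝 (∑ i, Complex.exp (Complex.I * (ξ * symbolVelocity i k)))) := by
  let σ : ArcType ≃ BandIndex := Fintype.equivOfCardEq card_bandIndex
  have h := tendsto_trace_conj_pow_mul_pow (v := fun a => symbolEigenvector (σ a))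
    (ν := fun a => symbolEigenvalue (σ a)) walkSymbol_unitary
    (fun a => continuousAt_symbolEigenvector hs (σ a))
    (fun a => symbolEigenvector_ne_zero hs (σ a))
    (fun a => .of_forall fun k => walkSymbol_mulVec_symbolEigenvector (σ a) k)
    (fun a => hasDerivAt_symbolEigenvalue hs (σ a))
    (fun a => .of_forall fun k => star_symbolEigenvalue_mul (σ a) k)
    ((injective_symbolEigenvalue hs hc).comp σ.injective) ξ
  convert h using 2
  rw [← σ.sum_comp]
  refine Finset.sum_congr rfl fun a _ => ?_
  congr 1
  linear_combination (-(ξ * Complex.I * symbolVelocity (σ a) k)) *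
    star_symbolEigenvalue_mul (σ a) k

/-! ### The probability of staying in the initial cell -/

theorem sum_norm_sq_mul_unitary {n : Type*} [Fintype n] [DecidableEq n] (N : Matrix n n ℂ)
    {V : Matrix n n ℂ} (hV : Vᴴ * V = 1) :
    ∑ i, ∑ a, ‖(N * V) a i‖ ^ 2 = ∑ i, ∑ a, ‖N a i‖ ^ 2 := by
  have htr : ∀ A : Matrix n n ℂ, trace (Aᴴ * A) = ((∑ i, ∑ a, ‖A a i‖ ^ 2 : ℝ) : ℂ) := by
    intro A
    push_cast
    simp only [trace, diag_apply, Matrix.mul_apply, conjTranspose_apply]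
    refine Finset.sum_congr rfl fun i _ => Finset.sum_congr rfl fun a _ => ?_
    rw [Complex.star_def, Complex.conj_mul']
  apply Complex.ofReal_injective
  rw [← htr, ← htr, conjTranspose_mul, mul_assoc, trace_mul_comm, mul_assoc, mul_assoc,
    mul_eq_one_comm.1 hV, mul_one]

theorem symbolEigenvector_inr (m : Fin 2 ⊕ Fin 2) (k k' : ℝ) :
    symbolEigenvector (.inr m) k = symbolEigenvector (.inr m) k' := by
  rcases m with l | l
  · ext a
    cases a <;> simp [symbolEigenvector, bandVector, ArcType.shift, ArcType.tgt, ArcType.src, dipole]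
  · rfl

theorem symbolEigenvalue_inr (m : Fin 2 ⊕ Fin 2) (k k' : ℝ) :
    symbolEigenvalue (.inr m) k = symbolEigenvalue (.inr m) k' := by
  rcases m with l | l <;> rfl

theorem pow_mulVec_eq {n : Type*} [Fintype n] [DecidableEq n] {M : Matrix n n ℂ} {v : n → ℂ}
    {ν : ℂ} (h : M *ᵥ v = ν • v) (t : ℕ) : M ^ t *ᵥ v = ν ^ t • v := by
  induction t with
  | zero => simp
  | succ t ih => rw [pow_succ, ← mulVec_mulVec, h, mulVec_smul, ih, smul_smul, pow_succ']

/-- The block of U^t at cell 0 is the mean of M(k)^t over k. Since the vectors for ±i and ±1 are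
common eigenvectors for all k, they survive the averaging. -/
theorem walkAmp_mulVec_symbolEigenvector (t : ℕ) (m : Fin 2 ⊕ Fin 2) (k : ℝ) :
    (Matrix.of fun a e => walkAmp t e 0 a) *ᵥ symbolEigenvector (.inr m) k =
      symbolEigenvalue (.inr m) k ^ t • symbolEigenvector (.inr m) k := by
  ext a
  have hpi : (2 * Real.pi : ℂ) ≠ 0 := by
    simp
  apply mul_left_cancel₀ hpi
  simp only [mulVec, dotProduct, of_apply, Finset.mul_sum, ← mul_assoc, walkAmp_zero_cell]
  simp only [← intervalIntegral.integral_mul_const]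
  have hcont : ∀ e, Continuous fun k' : ℝ =>
      (walkSymbol k' ^ t) a e * symbolEigenvector (.inr m) k e := fun e =>
    ((continuous_walkSymbol.pow t).matrix_elem a e).mul continuous_const
  rw [← intervalIntegral.integral_finsetSum fun e _ => (hcont e).intervalIntegrable _ _]
  have h : ∀ k' : ℝ, ∑ e, (walkSymbol k' ^ t) a e * symbolEigenvector (.inr m) k e =
      symbolEigenvalue (.inr m) k ^ t * symbolEigenvector (.inr m) k a := by
    intro k'
    have := congrFun (pow_mulVec_eq (walkSymbol_mulVec_symbolEigenvector (.inr m) k') t) a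
    rw [symbolEigenvector_inr m k' k, symbolEigenvalue_inr m k' k] at this
    exact this
  simp only [h, intervalIntegral.integral_const, Complex.real_smul, sub_zero]
  push_cast
  simp [mul_assoc]

/-- The return probability is 1/10 of the squared Hilbert–Schmidt norm of the block at cell 0. In an
orthonormal eigenbasis of the symbol, the four k-independent vectors each contribute exactly 1. -/
theorem two_fifths_le_cellProb (t : ℕ) : 2 / 5 ≤ cellProb t 0 := by
  let σ : ArcType ≃ BandIndex := Fintype.equivOfCardEq card_bandIndex
  -- Any wave number with nonzero sine and cosine would do: it only serves to complete the four
  -- vectors to an orthonormal basis.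
  have hs : Real.sin (Real.pi / 4) ≠ 0 := by rw [Real.sin_pi_div_four]; positivity
  have hc : Real.cos (Real.pi / 4) ≠ 0 := by rw [Real.cos_pi_div_four]; positivity
  set k := Real.pi / 4
  set V : Matrix ArcType ArcType ℂ := normalizedColumns fun a => symbolEigenvector (σ a) k with hVd
  have hV : Vᴴ * V = 1 := normalizedColumns_unitary
    (fun a => symbolEigenvector_ne_zero hs (σ a)) fun a b hab =>
      star_dotProduct_eq_zero_of_eigen (walkSymbol_unitary k)
        (walkSymbol_mulVec_symbolEigenvector (σ a) k) (walkSymbol_mulVec_symbolEigenvector (σ b) k)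
        (star_symbolEigenvalue_mul (σ a) k)
        ((injective_symbolEigenvalue hs hc).ne (σ.injective.ne hab))
  set N : Matrix ArcType ArcType ℂ := Matrix.of fun a e => walkAmp t e 0 a
  have hcol : ∀ i, ∑ a, ‖V a i‖ ^ 2 = 1 := by
    intro i
    have h1 := congrFun (congrFun hV i) i
    rw [Matrix.mul_apply, one_apply_eq] at h1
    apply Complex.ofReal_injective
    rw [Complex.ofReal_one, ← h1]
    push_cast
    refine Finset.sum_congr rfl fun a _ => ?_
    rw [conjTranspose_apply, Complex.star_def, Complex.conj_mul']
  have hflat : ∀ m : Fin 2 ⊕ Fin 2, ∑ a, ‖(N * V) a (σ.symm (.inr m))‖ ^ 2 = 1 := by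
    intro m
    rw [← hcol (σ.symm (.inr m))]
    refine Finset.sum_congr rfl fun a _ => ?_
    have h1 : (N * V) a (σ.symm (.inr m)) =
        symbolEigenvalue (.inr m) k ^ t * V a (σ.symm (.inr m)) := by
      have h2 := congrFun (walkAmp_mulVec_symbolEigenvector t m k) a
      simp only [mulVec, dotProduct, Pi.smul_apply, smul_eq_mul] at h2
      rw [Matrix.mul_apply, hVd]
      simp only [normalizedColumns, of_apply, Complex.real_smul, Equiv.apply_symm_apply]
      rw [mul_left_comm, ← h2, Finset.mul_sum]
      exact Finset.sum_congr rfl fun e _ => by ring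
    have h3 : ‖symbolEigenvalue (.inr m) k‖ = 1 := by
      have := congrArg norm (star_symbolEigenvalue_mul (.inr m) k)
      rw [norm_mul, norm_star, norm_one] at this
      nlinarith [norm_nonneg (symbolEigenvalue (.inr m) k)]
    rw [h1, norm_mul, norm_pow, h3, one_pow, one_mul]
  have hsum : 4 ≤ ∑ i, ∑ a, ‖(N * V) a i‖ ^ 2 := by
    rw [← σ.symm.sum_comp, Fintype.sum_sum_type]
    simp only [hflat]
    have : 0 ≤ ∑ x : Fin 3 × Fin 2, ∑ a, ‖(N * V) a (σ.symm (.inl x))‖ ^ 2 := by positivity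
    simp
    linarith
  rw [sum_norm_sq_mul_unitary N hV] at hsum
  have : cellProb t 0 = 1 / 10 * ∑ i, ∑ a, ‖N a i‖ ^ 2 := rfl
  rw [this]
  linarith

end Eigenvectors

/-! ### The limit of the characteristic functions -/

theorem measurable_bandVelocity {j : ℕ} (hj : j < 3) : Measurable (bandVelocity j) := by
  have := (continuous_cubicRoot hj).measurable
  unfold bandVelocity
  fun_prop

theorem ae_sin_cos_ne_zero : ∀ᵐ k : ℝ, Real.sin k ≠ 0 ∧ Real.cos k ≠ 0 := by
  have h : {k : ℝ | ¬(Real.sin k ≠ 0 ∧ Real.cos k ≠ 0)} ⊆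
      range fun n : ℤ => (n : ℝ) * Real.pi / 2 := by
    intro k hk
    have h2 : Real.sin (2 * k) = 0 := by
      rw [Real.sin_two_mul]
      by_contra h0
      exact hk ⟨fun h => h0 (by rw [h]; ring), fun h => h0 (by rw [h]; ring)⟩
    obtain ⟨n, hn⟩ := Real.sin_eq_zero_iff.1 h2
    exact ⟨n, by simp only; linarith⟩
  exact ((countable_range _).mono h).measure_zero _

theorem tendsto_charFun_rescaledLaw (ξ : ℝ) :
    Tendsto (fun t => charFun (rescaledLaw t) ξ) atTop (𝓝 (1 / (20 * Real.pi) *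
      ∫ k in (0 : ℝ)..2 * Real.pi, ∑ i, Complex.exp (Complex.I * (ξ * symbolVelocity i k)))) := by
  simp only [charFun_rescaledLaw]
  refine Tendsto.const_mul _ ?_
  refine intervalIntegral.tendsto_integral_filter_of_dominated_convergence (fun _ => 10) ?_ ?_
    intervalIntegrable_const ?_
  · refine .of_forall fun t => ?_
    refine Continuous.aestronglyMeasurable ?_
    have h1 := continuous_walkSymbol.pow t
    exact (h1.matrix_conjTranspose.matrix_mul
      (h1.comp (continuous_id.sub continuous_const))).matrix_trace
  · refine .of_forall fun t => .of_forall fun k _ => ?_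
    have h := norm_trace_conj_pow_mul_pow_le (walkSymbol_unitary k)
      (walkSymbol_unitary (k - ξ / t)) t
    rwa [ArcType.card_eq] at h
  · filter_upwards [ae_sin_cos_ne_zero] with k hk _
    exact tendsto_trace_walkSymbol hk.1 hk.2 ξ

theorem norm_exp_I_mul (ξ y : ℝ) : ‖Complex.exp (Complex.I * (ξ * y))‖ = 1 := by
  rw [← Complex.ofReal_mul, mul_comm, Complex.norm_exp_ofReal_mul_I]

theorem intervalIntegrable_exp_velocity {w : ℝ → ℝ} (hw : Measurable w) (ξ a b : ℝ) :
    IntervalIntegrable (fun k => Complex.exp (Complex.I * (ξ * w k))) volume a b := by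
  refine (intervalIntegrable_const (c := (1 : ℝ))).mono_fun ?_ (.of_forall fun k => ?_)
  · exact Measurable.aestronglyMeasurable (by fun_prop)
  · simp only [norm_exp_I_mul, norm_one, le_refl]

theorem integral_neg_of_odd_reflection {w : ℝ → ℝ} {c d : ℝ} (f : ℝ → ℂ)
    (h : ∀ k, w (c + d - k) = -w k) : ∫ k in c..d, f (-w k) = ∫ k in c..d, f (w k) := by
  have := intervalIntegral.integral_comp_sub_left (a := c) (b := d) (fun k => f (w k)) (c + d)
  simpa [h] using this

theorem integral_bandVelocity_zero_neg (f : ℝ → ℂ) :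
    ∫ k in (0 : ℝ)..2 * Real.pi, f (-bandVelocity 0 k) =
      ∫ k in (0 : ℝ)..2 * Real.pi, f (bandVelocity 0 k) :=
  integral_neg_of_odd_reflection f fun k => by rw [zero_add, bandVelocity_two_pi_sub]

theorem periodic_bandVelocity (j : ℕ) (f : ℝ → ℂ) :
    Function.Periodic (fun k => f (bandVelocity j k)) (2 * Real.pi) := fun k => by
  simp only [bandVelocity_add_two_pi]

theorem integral_bandVelocity_zero_add_pi (f : ℝ → ℂ) :
    ∫ k in (0 : ℝ)..2 * Real.pi, f (bandVelocity 0 (k + Real.pi)) =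
      ∫ k in (0 : ℝ)..2 * Real.pi, f (bandVelocity 0 k) := by
  rw [intervalIntegral.integral_comp_add_right fun k => f (bandVelocity 0 k)]
  have := (periodic_bandVelocity 0 f).intervalIntegral_add_eq 0 Real.pi
  simp only [zero_add] at this ⊢
  rw [this, add_comm]

/-- A shift by π negates the velocity of band 2, and oddness undoes the sign, so the two half
periods contribute equally. -/
theorem integral_bandVelocity_two {f : ℝ → ℂ}
    (hf : ∀ a b, IntervalIntegrable (fun k => f (bandVelocity 2 k)) volume a b) :
    ∫ k in (0 : ℝ)..2 * Real.pi, f (bandVelocity 2 k) =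
      2 * ∫ k in -(Real.pi / 2)..Real.pi / 2, f (bandVelocity 2 k) := by
  have h1 := (periodic_bandVelocity 2 f).intervalIntegral_add_eq 0 (-(Real.pi / 2))
  rw [zero_add] at h1
  have h2 : ∫ k in Real.pi / 2..-(Real.pi / 2) + 2 * Real.pi, f (bandVelocity 2 k) =
      ∫ k in -(Real.pi / 2)..Real.pi / 2, f (bandVelocity 2 k) := by
    have h3 := integral_neg_of_odd_reflection (w := bandVelocity 2) (c := -(Real.pi / 2))
      (d := Real.pi / 2) f fun k => by rw [neg_add_cancel, zero_sub, bandVelocity_neg]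
    have := intervalIntegral.integral_comp_add_right (a := -(Real.pi / 2)) (b := Real.pi / 2)
      (fun k => f (bandVelocity 2 k)) Real.pi
    simp only [bandVelocity_two_add_pi] at this
    rw [← h3, this]
    congr 1 <;> ring
  rw [h1, ← intervalIntegral.integral_add_adjacent_intervals (hf _ _) (hf _ _), h2]
  ring

/-- The four zero velocities give 8π. Bands 0 and 1 with both signs give four equal integrals; band
2 with both signs gives two, each twice the integral over a half period. -/
theorem integral_sum_exp_velocity (ξ : ℝ) :
    ∫ k in (0 : ℝ)..2 * Real.pi, ∑ i, Complex.exp (Complex.I * (ξ * symbolVelocity i k)) =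
      8 * Real.pi +
      4 * (∫ k in (0 : ℝ)..2 * Real.pi, Complex.exp (Complex.I * (ξ * bandVelocity 0 k))) +
      4 * ∫ k in -(Real.pi / 2)..Real.pi / 2, Complex.exp (Complex.I * (ξ * bandVelocity 2 k)) := by
  -- The exponential is made opaque so that the symmetries can be used by rewriting the argument of
  -- f.
  obtain ⟨f, hf⟩ : ∃ f : ℝ → ℂ, ∀ y : ℝ, Complex.exp (Complex.I * (ξ * y)) = f y := ⟨_, fun _ => rfl⟩
  have hi : ∀ j < 3, ∀ a b, IntervalIntegrable (fun k => f (bandVelocity j k)) volume a b :=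
    fun j hj a b => by
      simpa only [hf] using intervalIntegrable_exp_velocity (measurable_bandVelocity hj) ξ a b
  have hi' : ∀ j < 3, ∀ a b, IntervalIntegrable (fun k => f (-bandVelocity j k)) volume a b :=
    fun j hj a b => by
      have := intervalIntegrable_exp_velocity (measurable_bandVelocity hj).neg ξ a b
      simpa only [Pi.neg_apply, hf] using this
  have hs : ∀ j < 3, ∀ a b, IntervalIntegrable
      (fun k => f (bandVelocity j k) + f (-bandVelocity j k)) volume a b :=
    fun j hj a b => (hi j hj a b).add (hi' j hj a b)
  have hs' : ∀ j < 3, ∫ k in (0 : ℝ)..2 * Real.pi, (f (bandVelocity j k) + f (-bandVelocity j k)) =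
      (∫ k in (0 : ℝ)..2 * Real.pi, f (bandVelocity j k)) +
        ∫ k in (0 : ℝ)..2 * Real.pi, f (-bandVelocity j k) :=
    fun j hj => intervalIntegral.integral_add (hi j hj _ _) (hi' j hj _ _)
  have h1 : ∀ k, ∑ i, f (symbolVelocity i k) =
      (f (bandVelocity 0 k) + f (-bandVelocity 0 k)) +
      (f (bandVelocity 1 k) + f (-bandVelocity 1 k)) +
      (f (bandVelocity 2 k) + f (-bandVelocity 2 k)) + 4 := by
    intro k
    have h0 : f 0 = 1 := by rw [← hf]; simp
    simp only [Fintype.sum_sum_type, Fintype.sum_prod_type, Fin.sum_univ_three, Fin.sum_univ_two,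
      symbolVelocity, h0]
    simp
    norm_num
  simp only [hf, h1]
  have h01 := (hs 0 (by norm_num) 0 (2 * Real.pi)).add (hs 1 (by norm_num) _ _)
  have h012 := h01.add (hs 2 (by norm_num) _ _)
  rw [intervalIntegral.integral_add h012 intervalIntegrable_const,
    intervalIntegral.integral_add h01 (hs 2 (by norm_num) _ _),
    intervalIntegral.integral_add (hs 0 (by norm_num) _ _) (hs 1 (by norm_num) _ _),
    hs' 0 (by norm_num), hs' 1 (by norm_num), hs' 2 (by norm_num)]
  · have hb : ∫ k in (0 : ℝ)..2 * Real.pi, f (-bandVelocity 2 k) =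
        ∫ k in (0 : ℝ)..2 * Real.pi, f (bandVelocity 2 k) :=
      integral_neg_of_odd_reflection f fun k => by rw [zero_add, bandVelocity_two_pi_sub]
    have hc : ∫ k in (0 : ℝ)..2 * Real.pi, f (-bandVelocity 1 k) =
        ∫ k in (0 : ℝ)..2 * Real.pi, f (bandVelocity 0 k) := by
      simp only [bandVelocity_one, neg_neg]
      exact integral_bandVelocity_zero_add_pi f
    have hd : ∫ k in (0 : ℝ)..2 * Real.pi, f (bandVelocity 1 k) =
        ∫ k in (0 : ℝ)..2 * Real.pi, f (bandVelocity 0 k) := by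
      simp only [bandVelocity_one]
      rw [integral_bandVelocity_zero_add_pi fun y => f (-y), integral_bandVelocity_zero_neg]
    rw [hb, hc, hd, integral_bandVelocity_zero_neg, integral_bandVelocity_two (hi 2 (by norm_num)),
      intervalIntegral.integral_const, Complex.real_smul]
    push_cast
    ring

/-! ### The limit law -/

/-- The total density of the absolutely continuous part of the limit law. -/
noncomputable def limitDensity (y : ℝ) : ℝ :=
  bandDensity 1 (1 / √10) y + bandDensity (-1) (2 / 7) y

/-- The limit law of `X_t / t`. -/
noncomputable def limitLaw : Measure ℝ :=
  (2 / 5 : ℝ≥0∞) • Measure.dirac (0 : ℝ) +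
    (3 / 5 : ℝ≥0∞) • volume.withDensity fun y => ENNReal.ofReal (limitDensity y)

theorem limitDensity_nonneg (y : ℝ) : 0 ≤ limitDensity y :=
  add_nonneg (isBand_zero.bandDensity_nonneg y) (isBand_two.bandDensity_nonneg y)

theorem integrable_limitDensity : Integrable limitDensity :=
  isBand_zero.integrable_bandDensity.add isBand_two.integrable_bandDensity

theorem integral_limitDensity : ∫ y, limitDensity y = 1 := by
  have h : ∫ y, limitDensity y = (∫ y, bandDensity 1 (1 / √10) y) +
      ∫ y, bandDensity (-1) (2 / 7) y :=
    integral_add isBand_zero.integrable_bandDensity isBand_two.integrable_bandDensity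
  rw [h, isBand_zero.integral_bandDensity, isBand_two.integral_bandDensity]
  have := Real.pi_ne_zero
  field_simp
  ring

theorem lintegral_limitDensity : ∫⁻ y, ENNReal.ofReal (limitDensity y) = 1 := by
  rw [← ofReal_integral_eq_lintegral_ofReal integrable_limitDensity
    (.of_forall limitDensity_nonneg), integral_limitDensity, ENNReal.ofReal_one]

instance isProbabilityMeasure_limitDensity :
    IsProbabilityMeasure (volume.withDensity fun y => ENNReal.ofReal (limitDensity y)) :=
  ⟨by rw [withDensity_apply _ MeasurableSet.univ, Measure.restrict_univ, lintegral_limitDensity]⟩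

instance isProbabilityMeasure_limitLaw : IsProbabilityMeasure limitLaw := by
  refine ⟨?_⟩
  rw [limitLaw, Measure.add_apply, Measure.smul_apply, Measure.smul_apply, measure_univ,
    measure_univ, smul_eq_mul, smul_eq_mul, mul_one, mul_one, ← ENNReal.add_div]
  norm_num
  exact ENNReal.div_self (by norm_num) (by norm_num)

theorem charFun_limitLaw (ξ : ℝ) : charFun limitLaw ξ = 1 / (20 * Real.pi) *
    ∫ k in (0 : ℝ)..2 * Real.pi, ∑ i, Complex.exp (Complex.I * (ξ * symbolVelocity i k)) := by
  have hb : ∀ μ : Measure ℝ, IsProbabilityMeasure μ →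
      Integrable (fun y : ℝ => Complex.exp (Complex.I * (ξ * y))) μ := fun μ _ =>
    (integrable_const (1 : ℝ)).mono' (by fun_prop) (.of_forall fun y => (norm_exp_I_mul ξ y).le)
  have hJ : ∀ {j : ℕ} {c d ε a : ℝ}, IsBand j c d ε a →
      Integrable fun y : ℝ => bandDensity ε a y • Complex.exp (Complex.I * (ξ * y)) := fun h =>
    h.integrable_bandDensity.norm.mono' (h.integrable_bandDensity.aestronglyMeasurable.smul
      (by fun_prop)) (.of_forall fun y => by rw [norm_smul, norm_exp_I_mul, mul_one])
  have hm : AEMeasurable limitDensity := integrable_limitDensity.aestronglyMeasurable.aemeasurable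
  have h1 : ∫ y : ℝ, Complex.exp (Complex.I * (ξ * y))
      ∂(volume.withDensity fun y => ENNReal.ofReal (limitDensity y)) =
      ∫ y : ℝ, limitDensity y • Complex.exp (Complex.I * (ξ * y)) := by
    rw [integral_withDensity_eq_integral_toReal_smul₀ hm.ennreal_ofReal (by simp)]
    refine integral_congr_ae (.of_forall fun y => ?_)
    simp only
    rw [ENNReal.toReal_ofReal (limitDensity_nonneg y)]
  have h2 : charFun limitLaw ξ = ∫ y : ℝ, Complex.exp (Complex.I * (ξ * y)) ∂limitLaw := by
    rw [charFun_apply_real]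
    simp only [mul_comm]
  rw [h2, limitLaw, integral_add_measure, integral_smul_measure, integral_smul_measure,
    integral_dirac, h1]
  · simp only [limitDensity, add_smul]
    rw [integral_add (hJ isBand_zero) (hJ isBand_two),
      isBand_zero.integral_bandDensity_smul fun y => Complex.exp (Complex.I * (ξ * y)),
      isBand_two.integral_bandDensity_smul fun y => Complex.exp (Complex.I * (ξ * y)),
      integral_sum_exp_velocity]
    have hpi : (Real.pi : ℂ) ≠ 0 := by exact_mod_cast Real.pi_ne_zero
    simp [ENNReal.toReal_div]
    field_simp
    ring
  · exact (hb _ inferInstance).smul_measure (ENNReal.div_ne_top (by norm_num) (by norm_num))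
  · exact (hb _ inferInstance).smul_measure (ENNReal.div_ne_top (by norm_num) (by norm_num))

/-- The law of `X_t / t`, as a probability measure. -/
noncomputable def rescaledProb (t : ℕ) : ProbabilityMeasure ℝ := ⟨rescaledLaw t, inferInstance⟩

theorem tendsto_rescaledProb :
    Tendsto rescaledProb atTop (𝓝 (⟨limitLaw, inferInstance⟩ : ProbabilityMeasure ℝ)) := by
  refine ProbabilityMeasure.tendsto_of_tendsto_charFun fun ξ => ?_
  change Tendsto (fun t => charFun (rescaledLaw t) ξ) atTop (𝓝 (charFun limitLaw ξ))
  rw [charFun_limitLaw]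
  exact tendsto_charFun_rescaledLaw ξ

theorem withDensity_limitDensity_singleton (x : ℝ) :
    (volume.withDensity fun y => ENNReal.ofReal (limitDensity y)) {x} = 0 :=
  withDensity_absolutelyContinuous _ _ Real.volume_singleton

theorem limitLaw_singleton {x : ℝ} (hx : x ≠ 0) : limitLaw {x} = 0 := by
  rw [limitLaw, Measure.add_apply, Measure.smul_apply, Measure.smul_apply,
    withDensity_limitDensity_singleton, Measure.dirac_apply' _ (measurableSet_singleton x)]
  simp [hx.symm]

theorem limitLaw_singleton_zero : limitLaw {0} = 2 / 5 := by
  rw [limitLaw, Measure.add_apply, Measure.smul_apply, Measure.smul_apply,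
    withDensity_limitDensity_singleton, Measure.dirac_apply' _ (measurableSet_singleton 0)]
  simp

theorem two_fifths_le_rescaledLaw {t : ℕ} : 2 / 5 ≤ rescaledLaw t {0} := by
  -- The inequality also covers `t = 0`, where `j / 0 = 0` for every cell.
  have h1 : averagedLaw t {0} ≤ rescaledLaw t {0} := by
    rw [rescaledLaw, Measure.map_apply (measurable_of_countable _) (measurableSet_singleton _)]
    refine measure_mono ?_
    rintro _ rfl
    simp
  refine le_trans ?_ h1
  rw [averagedLaw_singleton]
  refine le_trans ?_ (ENNReal.ofReal_le_ofReal (two_fifths_le_cellProb t))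
  rw [ENNReal.ofReal_div_of_pos (by norm_num)]
  simp

/-- For x ≠ 0 the boundary point has no limit mass and the portmanteau theorem suffices. At x = 0
the closed half-line bounds the limsup, and the open half-line together with the uniform mass 2/5 at
0 bounds the liminf. -/
theorem tendsto_rescaledLaw_Iic (x : ℝ) :
    Tendsto (fun t => rescaledLaw t (Iic x)) atTop (𝓝 (limitLaw (Iic x))) := by
  have hw := tendsto_rescaledProb
  by_cases hx : x = 0
  · subst hx
    have hsup : limsup (fun t => rescaledLaw t (Iic 0)) atTop ≤ limitLaw (Iic 0) :=
      ProbabilityMeasure.limsup_measure_closed_le_of_tendsto hw isClosed_Iic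
    have hinf : limitLaw (Iio 0) ≤ liminf (fun t => rescaledLaw t (Iio 0)) atTop :=
      ProbabilityMeasure.le_liminf_measure_open_of_tendsto hw isOpen_Iio
    have hsplit : ∀ μ : Measure ℝ, μ (Iic 0) = μ (Iio 0) + μ {0} := fun μ => by
      rw [← measure_union (by simp) (measurableSet_singleton _), Iio_union_right]
    refine tendsto_of_le_liminf_of_limsup_le ?_ hsup
    rw [hsplit, limitLaw_singleton_zero]
    have h1 : (fun t => rescaledLaw t (Iio 0) + 2 / 5) ≤ fun t => rescaledLaw t (Iic 0) := fun t => by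
      change rescaledLaw t (Iio 0) + 2 / 5 ≤ rescaledLaw t (Iic 0)
      rw [hsplit]
      gcongr
      exact two_fifths_le_rescaledLaw
    refine le_trans ?_ (liminf_le_liminf (.of_forall h1))
    rw [liminf_add_const atTop _ _ (by isBoundedDefault) (by isBoundedDefault)]
    gcongr
  · refine ProbabilityMeasure.tendsto_measure_of_null_frontier_of_tendsto' hw ?_
    rw [frontier_Iic]
    exact limitLaw_singleton hx

theorem mainTheorem6 :
    ∃ ν₀ ν₁ : ℝ → ℝ,
      -- limit law of `X_t / t`: convergence of the distribution function at every point
      (∀ x : ℝ, Tendsto (fun t : ℕ => averagedLaw t {j : ℤ | (j : ℝ) / (t : ℝ) ≤ x}) atTop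
        (𝓝 (((2 / 5 : ℝ≥0∞) • Measure.dirac (0 : ℝ) +
          (3 / 5 : ℝ≥0∞) • volume.withDensity (fun y => ENNReal.ofReal (ν₀ y + ν₁ y)))
            (Iic x)))) ∧
      -- nonnegativity, supports and continuity
      (∀ y, 0 ≤ ν₀ y) ∧ (∀ y, 0 ≤ ν₁ y) ∧
      Function.support ν₀ = Ioo (-(1 / √10)) (1 / √10) ∧
      Function.support ν₁ = Ioo (-(2 / 7)) (2 / 7) ∧
      ContinuousOn ν₀ (Ioo (-(1 / √10)) (1 / √10)) ∧
      ContinuousOn ν₁ (Ioo (-(2 / 7)) (2 / 7)) ∧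
      -- blow-up at the boundaries of the supports
      Tendsto ν₀ (𝓝[>] (-(1 / √10))) atTop ∧ Tendsto ν₀ (𝓝[<] (1 / √10)) atTop ∧
      Tendsto ν₁ (𝓝[>] (-(2 / 7))) atTop ∧ Tendsto ν₁ (𝓝[<] (2 / 7)) atTop ∧
      -- parametric expressions
      (∀ k ∈ Ioo 0 (2 * Real.pi), DifferentiableAt ℝ (walkEigenvalue 0 0) k ∧
        DifferentiableAt ℝ (groupVelocity 0 0) k ∧ deriv (groupVelocity 0 0) k ≠ 0) ∧
      (∀ k ∈ Ioo (-(Real.pi / 2)) (Real.pi / 2), DifferentiableAt ℝ (walkEigenvalue 2 0) k ∧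
        DifferentiableAt ℝ (groupVelocity 2 0) k ∧ deriv (groupVelocity 2 0) k ≠ 0) ∧
      (fun y => (y, ν₀ y)) '' Ioo (-(1 / √10)) (1 / √10) =
        (fun k => (groupVelocity 0 0 k, 1 / (3 * Real.pi * |deriv (groupVelocity 0 0) k|))) ''
          Ioo 0 (2 * Real.pi) ∧
      (fun y => (y, ν₁ y)) '' Ioo (-(2 / 7)) (2 / 7) =
        (fun k => (groupVelocity 2 0 k, 1 / (3 * Real.pi * |deriv (groupVelocity 2 0) k|))) ''
          Ioo (-(Real.pi / 2)) (Real.pi / 2) := by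
  have h10 : -(1 / √10) < 1 / √10 := neg_lt_self (by positivity)
  have h7 : (-(2 / 7) : ℝ) < 2 / 7 := by norm_num
  refine ⟨bandDensity 1 (1 / √10), bandDensity (-1) (2 / 7), fun x => ?_,
    isBand_zero.bandDensity_nonneg, isBand_two.bandDensity_nonneg,
    isBand_zero.support_bandDensity, isBand_two.support_bandDensity,
    isBand_zero.continuousOn_bandDensity, isBand_two.continuousOn_bandDensity, ?_, ?_, ?_, ?_,
    differentiableAt_groupVelocity isBand_zero, differentiableAt_groupVelocity isBand_two,
    graph_groupVelocity isBand_zero, graph_groupVelocity isBand_two⟩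
  · refine (tendsto_rescaledLaw_Iic x).congr fun t => ?_
    rw [rescaledLaw, Measure.map_apply (measurable_of_countable _) measurableSet_Iic]
    rfl
  · rw [← nhdsWithin_Ioo_eq_nhdsGT h10]
    exact isBand_zero.tendsto_bandDensity (left_mem_Icc.2 h10.le) (neg_sq _)
  · rw [← nhdsWithin_Ioo_eq_nhdsLT h10]
    exact isBand_zero.tendsto_bandDensity (right_mem_Icc.2 h10.le) rfl
  · rw [← nhdsWithin_Ioo_eq_nhdsGT h7]
    exact isBand_two.tendsto_bandDensity (left_mem_Icc.2 h7.le) (neg_sq _)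
  · rw [← nhdsWithin_Ioo_eq_nhdsLT h7]
    exact isBand_two.tendsto_bandDensity (right_mem_Icc.2 h7.le) rfl
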